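/- Let $(W,R)$ be a Coxeter system of type $F_4$, let $T$ be its set of reflections (conjugates of elements of $R$), let $\ell_T$ be the word length on $W$ with respect to $T$, and write $x\preceq w$ if $\ell_T(w)=\ell_T(x)+\ell_T(x^{-1}w)$. Let $w\in W$ be a proper quasi-Coxeter element, that is, $w$ has a decomposition $w=t_1\cdots t_k$ into reflections with $k=\ell_T(w)$ and $\langle t_1,\dots,t_k\rangle=W$, and $w$ is not conjugate to a product of all elements of $R$ in some order. Let $[1,w]=\{x\in W : x\preceq w\}$, and let $G([1,w])$ be the interval group: it is generated by symbols $\boldsymbol{x}$, $x\in[1,w]$, with the relations $\boldsymbol{u}\boldsymbol{v}=\boldsymbol{r}$ whenever $u,v,r\in[1,w]$, $uv=r$ and $\ell_T(r)=\ell_T(u)+\ell_T(v)$. The Carter diagram $F_4(a_1)$ is the $4$-cycle on the vertices $s_1,s_2,s_3,s_4$ with single edges $\{s_1,s_2\},\{s_3,s_4\}$ and double edges $\{s_1,s_4\},\{s_2,s_3\}$. Then $F_4(a_1)$ is a Carter diagram of $w$: there are reflections $s_1,s_2,s_3,s_4\in T$ such that $s_is_j$ $(i\neq j)$ has order $2$,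 $3$ or $4$ according to whether the vertices $s_i,s_j$ are joined by no edge, a single edge or a double edge, and $w$ is the product of the $s_i$, each used once, in an order giving a reduced bipartite decomposition $w=w_1w_2$ (the factors within $w_1$ commute pairwise, and likewise within $w_2$). Moreover these can be chosen so that $G([1,w])$ is presented on the corresponding generators $\boldsymbol{s}_1,\boldsymbol{s}_2,\boldsymbol{s}_3,\boldsymbol{s}_4$ by the braid relations of $F_4(a_1)$, $$\boldsymbol{s}_1\boldsymbol{s}_2\boldsymbol{s}_1=\boldsymbol{s}_2\boldsymbol{s}_1\boldsymbol{s}_2,\quad \boldsymbol{s}_3\boldsymbol{s}_4\boldsymbol{s}_3=\boldsymbol{s}_4\boldsymbol{s}_3\boldsymbol{s}_4,\quad \boldsymbol{s}_1\boldsymbol{s}_4\boldsymbol{s}_1\boldsymbol{s}_4=\boldsymbol{s}_4\boldsymbol{s}_1\boldsymbol{s}_4\boldsymbol{s}_1,\quad \boldsymbol{s}_2\boldsymbol{s}_3\boldsymbol{s}_2\boldsymbol{s}_3=\boldsymbol{s}_3\boldsymbol{s}_2\boldsymbol{s}_3\boldsymbol{s}_2,\quad \boldsymbol{s}_1\boldsymbol{s}_3=\boldsymbol{s}_3\boldsymbol{s}_1,\quad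 \boldsymbol{s}_2\boldsymbol{s}_4=\boldsymbol{s}_4\boldsymbol{s}_2,$$ together with the commutator relators $[\boldsymbol{s}_2^{-1}\boldsymbol{s}_1\boldsymbol{s}_2,\ \boldsymbol{s}_3^{-1}\boldsymbol{s}_4\boldsymbol{s}_3]$ and $[\boldsymbol{s}_2\boldsymbol{s}_1\boldsymbol{s}_2^{-1},\ \boldsymbol{s}_3\boldsymbol{s}_4\boldsymbol{s}_3^{-1}]$. Furthermore, $G([1,w])$ is not isomorphic to the Artin group $A(F_4)$. -/

import Mathlib

namespace DualCoxeter

section Dual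

variable {B W : Type*} [Group W] {M : CoxeterMatrix B}

/-- The reflection length `ℓ_T(w)`: the least `k` such that `w` is a product of `k` reflections. -/
noncomputable def reflectionLength (cs : CoxeterSystem M W) (w : W) : ℕ :=
  sInf {k : ℕ | ∃ l : List W, l.length = k ∧ (∀ t ∈ l, cs.IsReflection t) ∧ l.prod = w}

/-- `l = (t₁, …, t_k)` is a reduced decomposition of `w` into reflections. -/
def IsReducedDecomposition (cs : CoxeterSystem M W) (w : W) (l : List W) : Prop :=
  (∀ t ∈ l, cs.IsReflection t) ∧ l.prod = w ∧ l.length = reflectionLength cs w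

/-- A Coxeter element: a conjugate of the product of all simple reflections in some order. -/
def IsCoxeterElement (cs : CoxeterSystem M W) (w : W) : Prop :=
  ∃ l : List B, l.Nodup ∧ (∀ i, i ∈ l) ∧ IsConj (cs.wordProd l) w

/-- A quasi-Coxeter element: some reduced decomposition into reflections generates `W`. -/
def IsQuasiCoxeter (cs : CoxeterSystem M W) (w : W) : Prop :=
  ∃ l : List W, IsReducedDecomposition cs w l ∧ Subgroup.closure {t | t ∈ l} = ⊤

/-- A quasi-Coxeter element is proper if it is not a Coxeter element. -/
def IsProperQuasiCoxeter (cs : CoxeterSystem M W) (w : W) : Prop :=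
  IsQuasiCoxeter cs w ∧ ¬ IsCoxeterElement cs w

/-- `x ≼ w` in the absolute order. -/
def AbsLE (cs : CoxeterSystem M W) (x w : W) : Prop :=
  ∃ y : W, w = x * y ∧ reflectionLength cs w = reflectionLength cs x + reflectionLength cs y

/-- The interval `[1, w]` of the absolute order. -/
def interval (cs : CoxeterSystem M W) (w : W) : Set W :=
  {x | AbsLE cs x w}

/-- The relators `𝐮 𝐯 𝐫⁻¹` for `u, v, r ∈ [1, w]` with `u v = r` and
`ℓ_T(r) = ℓ_T(u) + ℓ_T(v)`. -/
def intervalRels (cs : CoxeterSystem M W) (w : W) : Set (FreeGroup (interval cs w)) :=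
  {x | ∃ u v r : interval cs w, (u : W) * v = r ∧
    reflectionLength cs (r : W) = reflectionLength cs (u : W) + reflectionLength cs (v : W) ∧
    x = FreeGroup.of u * FreeGroup.of v * (FreeGroup.of r)⁻¹}

/-- The interval group `G([1, w])`. -/
abbrev IntervalGroup (cs : CoxeterSystem M W) (w : W) : Type _ :=
  PresentedGroup (intervalRels cs w)

/-- The family `t` of reflections realises the diagram `Δ` as a Carter diagram of `w`:
`w = w₁ w₂`, where `w₁`, `w₂` are products of pairwise commuting reflections, every `t i` is used
exactly once, the resulting decomposition of `w` is reduced, and the vertices `i ≠ j` are joined by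
`o(t i * t j) - 2` edges. Here a diagram is encoded by the symmetric matrix `Δ` with
`Δ i j - 2` the number of edges between `i ≠ j`. -/
structure IsCarterDiagram {ι : Type*} (cs : CoxeterSystem M W) (Δ : CoxeterMatrix ι)
    (t : ι → W) (w : W) : Prop where
  bipartite : ∃ l₁ l₂ : List ι, (l₁ ++ l₂).Nodup ∧ (∀ i, i ∈ l₁ ++ l₂) ∧
    (∀ i ∈ l₁, ∀ j ∈ l₁, Commute (t i) (t j)) ∧
    (∀ i ∈ l₂, ∀ j ∈ l₂, Commute (t i) (t j)) ∧
    IsReducedDecomposition cs w (l₁.map t ++ l₂.map t)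
  orderOf_mul : ∀ i j, orderOf (t i * t j) = Δ i j

end Dual

section Artin

variable {B : Type*}

/-- The braid relator `(⋯ i j) (⋯ j i)⁻¹`, with `M i j` letters in each alternating word. -/
def braidRel (M : CoxeterMatrix B) (i j : B) : FreeGroup B :=
  ((CoxeterSystem.braidWord M i j).map FreeGroup.of).prod *
    (((CoxeterSystem.braidWord M j i).map FreeGroup.of).prod)⁻¹

/-- The set `R(M)` of all braid relators. -/
def braidRels (M : CoxeterMatrix B) : Set (FreeGroup B) :=
  {x | ∃ i j, x = braidRel M i j}

/-- The Artin group `A(M)`. -/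
abbrev ArtinGroup (M : CoxeterMatrix B) : Type _ :=
  PresentedGroup (braidRels M)

end Artin

/-- The Carter diagram `F₄(a₁)`: the 4-cycle on `s₁, s₂, s₃, s₄` (indexed by `0, 1, 2, 3`) with
single edges `(s₁, s₂)`, `(s₃, s₄)` and double edges `(s₁, s₄)`, `(s₂, s₃)`. -/
def carterF₄a₁ : CoxeterMatrix (Fin 4) where
  M := !![1, 3, 2, 4;
          3, 1, 4, 2;
          2, 4, 1, 3;
          4, 2, 3, 1]
  isSymm := by
    ext i j
    fin_cases i <;> fin_cases j <;> rfl
  diagonal := by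
    intro i
    fin_cases i <;> rfl
  off_diagonal := by
    intro i j h
    fin_cases i <;> fin_cases j <;> simp at h ⊢

open scoped commutatorElement in
/-- The braid relators of `F₄(a₁)` together with `[s₂⁻¹ s₁ s₂, s₃⁻¹ s₄ s₃]` and
`[s₂ s₁ s₂⁻¹, s₃ s₄ s₃⁻¹]`. -/
def relsF₄a₁ : Set (FreeGroup (Fin 4)) :=
  let s : Fin 4 → FreeGroup (Fin 4) := FreeGroup.of
  braidRels carterF₄a₁ ∪
    {⁅(s 1)⁻¹ * s 0 * s 1, (s 2)⁻¹ * s 3 * s 2⁆,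
     ⁅s 1 * s 0 * (s 1)⁻¹, s 2 * s 3 * (s 2)⁻¹⁆}

end DualCoxeter

/-!
The proof goes through the dual presentation of the interval group. Write `W` for the Coxeter group
of type `F₄`, `T` for its 24 reflections and `w` for a proper quasi-Coxeter element.

*Computing in `W`.* A coset enumeration along the chain of standard parabolic subgroups shows that
every element of `W` is represented by one of 1152 explicit words (`exists_normalWord`). No
nontrivial one of these words fixes the sum of the fundamental weights in the reflection
representation, so equality in `W` can be tested on the orbit of this weight (`wordProd_eq_iff`).

*Reduction to one element.* Every element is a product of at most four reflections. If the factors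
`tᵢ` of a reduced decomposition of `w` generate `W`, then their roots span the weight space over
every field; hence there are four of them, and `w` fixes no nonzero vector over any field, that is,
no prime divides `det (w - 1)` (`not_dvd_det`). The elements for which 2 and 3 do not divide this
determinant form two conjugacy classes: that of the Coxeter elements, and that of the product
`s₁ s₃ s₂ s₄` of four reflections spanning `F₄(a₁)` (`isCoxeterElement_or_exists_conj`).
So `w` is conjugate to `s₁ s₃ s₂ s₄`, and all that is needed about `w` is collected in the notion
of a frame (`IsFrame`).

*The two presentations.* In the interval group, the lift of `x ≼ w` is the product of the lifts of
the factors of any reduced decomposition of `x`; so the interval group is generated by the lifts of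
the reflections, which satisfy the dual braid relations `a t = t (t a t)` for `a t ≼ w`. These give
the relations of `F₄(a₁)` (`carterRelations_of_dualBraid`), whence a homomorphism from the presented
group to the interval group. Conversely, in a group with four elements satisfying the relations of
`F₄(a₁)` let the other twenty reflections be represented by suitable conjugates of these elements.
Then 34 of the dual braid relations hold (`CarterRelations.dualBraid`), and a conjugation argument
derives all the others from them (`dualBraidOn_dualPairs`). Every decomposition of `w` into four
reflections is reached from `s₁ s₃ s₂ s₄` by Hurwitz moves, so all of them have the same product in
such a group (`mul_eq_of_mem_hurwitzOrbit`). Completing decompositions of `x ≼ w` to decompositions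
of `w`, the product of the lifts of the factors of `x` depends on `x` only; this defines the inverse
homomorphism (`IsFrame.exists_mulEquiv`).

*Comparison with the Artin group.* The presented group has 120 homomorphisms to the alternating
group of degree 4, and the Artin group of type `F₄` has 96.

The finite verifications are evaluated by the kernel; for the sake of speed, finite sets are stored
there as the binary digits of natural numbers.
-/

namespace DualCoxeter

namespace F₄

/-! ### The dual braid relations in an arbitrary group -/

/-- The conjugation table of the 24 reflections of `F₄`, numbered `0, …, 23` so that `0, 1, 2, 3`
span the diagram `F₄(a₁)`: row `a`, column `t` holds the number of the reflection `t a t`. -/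
def conjTable : List (List ℕ) :=
  [
    [0, 4, 0, 6, 1, 12, 0, 6, 13, 10, 9, 0, 0, 0, 15, 14, 13, 0, 12, 0, 22, 0, 20, 0],
    [4, 1, 9, 1, 0, 14, 20, 22, 9, 1, 13, 14, 15, 10, 1, 12, 1, 1, 1, 1, 6, 22, 1, 1],
    [2, 8, 2, 5, 16, 3, 17, 18, 2, 8, 16, 19, 17, 2, 2, 2, 2, 2, 7, 11, 2, 23, 2, 21],
    [7, 3, 5, 3, 21, 2, 7, 3, 11, 19, 3, 8, 3, 3, 19, 3, 23, 18, 17, 3, 21, 3, 3, 16],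
    [1, 0, 10, 20, 4, 4, 22, 4, 4, 13, 4, 15, 14, 9, 12, 4, 10, 4, 15, 4, 4, 20, 6, 4],
    [18, 11, 3, 2, 5, 5, 5, 17, 19, 5, 23, 5, 18, 5, 11, 5, 21, 7, 5, 8, 23, 16, 5, 5],
    [6, 20, 12, 0, 22, 6, 6, 0, 6, 15, 14, 13, 6, 6, 10, 9, 6, 12, 6, 6, 1, 6, 4, 13],
    [3, 21, 18, 7, 7, 17, 3, 7, 23, 7, 19, 16, 7, 7, 7, 19, 11, 5, 2, 7, 7, 7, 21, 8],
    [16, 2, 8, 11, 8, 19, 8, 23, 8, 2, 8, 3, 8, 16, 8, 17, 8, 8, 21, 5, 17, 18, 8, 7],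
    [10, 9, 1, 14, 13, 9, 15, 9, 1, 9, 0, 9, 20, 4, 9, 6, 9, 9, 22, 14, 12, 9, 9, 22],
    [9, 13, 4, 10, 10, 20, 14, 15, 10, 0, 10, 10, 22, 1, 6, 10, 4, 10, 10, 15, 10, 10, 12, 20],
    [11, 5, 19, 8, 18, 11, 23, 16, 3, 11, 11, 11, 11, 23, 5, 18, 7, 21, 11, 2, 11, 17, 11, 11],
    [12, 15, 6, 12, 14, 0, 12, 12, 12, 20, 22, 12, 12, 12, 4, 1, 12, 6, 0, 13, 9, 13, 10, 12],
    [13, 10, 13, 13, 9, 13, 13, 13, 0, 4, 1, 6, 13, 13, 20, 22, 0, 13, 13, 12, 14, 12, 15, 6],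
    [15, 14, 14, 9, 12, 1, 10, 14, 14, 14, 6, 1, 4, 20, 14, 0, 22, 22, 14, 9, 13, 14, 14, 14],
    [14, 12, 15, 15, 15, 15, 9, 10, 20, 6, 15, 4, 1, 22, 0, 15, 15, 20, 4, 10, 15, 15, 13, 15],
    [8, 16, 16, 23, 2, 21, 16, 11, 16, 16, 2, 7, 16, 8, 17, 16, 16, 16, 19, 18, 16, 5, 17, 3],
    [17, 17, 17, 18, 17, 7, 2, 5, 17, 17, 17, 21, 2, 17, 16, 8, 17, 17, 3, 23, 8, 11, 16, 19],
    [5, 18, 7, 17, 11, 18, 18, 2, 21, 23, 18, 18, 5, 18, 18, 11, 19, 3, 18, 16, 18, 8, 23, 18],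
    [19, 19, 11, 19, 19, 8, 19, 19, 5, 3, 7, 2, 21, 21, 3, 7, 18, 23, 16, 19, 19, 19, 19, 17],
    [22, 6, 20, 4, 20, 10, 1, 20, 15, 12, 20, 20, 9, 14, 13, 20, 20, 15, 20, 20, 20, 4, 0, 10],
    [21, 7, 23, 21, 3, 16, 21, 21, 18, 21, 21, 17, 19, 19, 21, 21, 5, 11, 8, 21, 3, 21, 7, 2],
    [20, 22, 22, 22, 6, 22, 4, 1, 22, 22, 12, 22, 10, 15, 22, 13, 14, 14, 9, 22, 0, 1, 22, 9],
    [23, 23, 21, 16, 23, 23, 11, 8, 7, 18, 5, 23, 23, 11, 23, 23, 3, 19, 23, 17, 5, 2, 18, 23]]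

/-- The number of the reflection `t a t`. -/
def conjIdx (a t : ℕ) : ℕ := (conjTable.getD a []).getD t 0 % 24

theorem conjIdx_lt (a t : ℕ) : conjIdx a t < 24 := Nat.mod_lt _ (by norm_num)

/-- Insertion into a finite set of naturals stored as the binary digits of a natural. -/
def bitInsert (n K : ℕ) : ℕ := K ||| 2 ^ n

theorem testBit_bitInsert {n K m : ℕ} (h : (bitInsert n K).testBit m = true) :
    m = n ∨ K.testBit m = true := by
  rw [bitInsert, Nat.testBit_or, Bool.or_eq_true, Nat.testBit_two_pow, decide_eq_true_eq] at h
  exact h.symm.imp_left Eq.symm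

section DualBraid

variable {G : Type*} [Group G]

/-- The dual braid relation `τ a * τ t = τ t * τ (t a t)` for a family `τ` indexed by the
reflections. -/
def DualBraid (τ : ℕ → G) (a t : ℕ) : Prop :=
  τ a * τ t = τ t * τ (conjIdx a t)

theorem dualBraid_iff (τ : ℕ → G) (a t : ℕ) :
    DualBraid τ a t ↔ τ (conjIdx a t) = (τ t)⁻¹ * τ a * τ t := by
  rw [DualBraid, mul_assoc, eq_inv_mul_iff_mul_eq, eq_comm]

/-- The dual braid relations hold for all pairs `(a, t)` in the set `K`, where `(a, t)` is encoded
as `24 * a + t`. -/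
def DualBraidOn (τ : ℕ → G) (K : ℕ) : Prop :=
  ∀ n, K.testBit n = true → DualBraid τ (n / 24) (n % 24)

/-- Thirty-four pairs whose dual braid relations imply all the others. -/
def basePairs : List (ℕ × ℕ) :=
  [
    (0, 1), (1, 4), (2, 3), (3, 5), (0, 3), (3, 6), (6, 7), (2, 1), (1, 8), (8, 9), (0, 2),
    (1, 3), (10, 2), (5, 1), (10, 3), (11, 0), (0, 5), (0, 8), (1, 11), (0, 14), (2, 4), (2, 6),
    (2, 7), (3, 14), (4, 3), (3, 20), (1, 21), (2, 21), (4, 0), (5, 2), (7, 0), (9, 2), (2, 0),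
    (3, 1)]

/-- For each `(a, t, u)`, the dual braid relation of `(t, u)` together with three of the relations
of `(a, t)`, `(a, u)`, `(t a t, u)` and `(u a u, u t u)` yields the fourth. Processing the list in
order leads from the relations of `basePairs` to those of every product `a t ≼ w`. -/
def squares : List (ℕ × ℕ × ℕ) :=
  [
    (2, 0, 1), (4, 7, 0), (2, 4, 0), (0, 3, 1), (7, 4, 0), (0, 9, 2), (3, 5, 1), (3, 1, 11),
    (1, 8, 4), (5, 9, 2), (8, 9, 4), (7, 11, 0), (2, 7, 0), (18, 2, 0), (9, 5, 2), (2, 1, 3),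
    (16, 7, 0), (2, 6, 7), (5, 2, 1), (1, 4, 3), (9, 10, 2), (1, 3, 11), (11, 0, 8), (1, 3, 20),
    (3, 6, 1), (2, 0, 3), (10, 0, 2), (4, 0, 3), (5, 6, 1), (0, 2, 3), (18, 4, 0), (10, 2, 3),
    (1, 8, 3), (10, 3, 5), (0, 2, 1), (9, 2, 3), (14, 10, 5), (0, 5, 2), (3, 14, 5), (3, 20, 6),
    (10, 18, 0), (0, 8, 9), (11, 16, 0), (5, 2, 6), (19, 9, 5), (10, 0, 3), (0, 9, 5), (20, 2, 6),
    (18, 0, 1), (9, 2, 4), (4, 16, 0), (16, 6, 7), (18, 10, 2), (4, 8, 3), (3, 5, 6), (5, 8, 9),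
    (12, 18, 2), (7, 18, 0), (8, 19, 9), (7, 0, 1), (7, 12, 18), (12, 7, 18), (6, 7, 1),
    (16, 10, 0), (4, 0, 8), (0, 9, 3), (0, 19, 9), (20, 2, 21), (14, 19, 5), (20, 21, 6),
    (2, 7, 1), (18, 8, 4), (14, 7, 5), (8, 13, 9), (4, 13, 16), (8, 9, 3), (20, 12, 2),
    (2, 1, 21), (7, 18, 1), (9, 20, 2), (0, 19, 5), (18, 1, 8), (10, 2, 6), (5, 12, 2),
    (1, 21, 4), (5, 1, 17), (4, 6, 7), (21, 4, 6), (7, 5, 12), (2, 22, 4), (2, 4, 6), (21, 4, 13),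
    (22, 16, 7), (12, 18, 8), (22, 7, 11), (6, 17, 7), (19, 12, 9), (13, 19, 9), (19, 5, 12),
    (20, 12, 21), (8, 12, 21), (0, 3, 14), (8, 13, 19), (20, 19, 12), (4, 3, 13), (11, 0, 14),
    (16, 14, 7), (7, 11, 14), (3, 6, 14), (16, 6, 14), (6, 22, 7), (8, 21, 9), (18, 8, 13),
    (16, 14, 19), (18, 4, 13), (1, 18, 8), (19, 0, 5), (12, 8, 21), (18, 9, 2), (19, 9, 10),
    (21, 18, 13), (21, 22, 11), (15, 19, 18), (12, 18, 1), (22, 4, 16), (13, 14, 19),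
    (23, 22, 16), (18, 13, 9), (23, 2, 6), (3, 11, 13), (9, 2, 21), (13, 23, 16), (17, 19, 12),
    (7, 14, 5), (11, 20, 13), (23, 6, 14), (10, 7, 18), (14, 15, 19), (1, 21, 18), (13, 23, 14),
    (22, 2, 7), (14, 5, 15), (2, 21, 6), (3, 11, 20), (14, 20, 19), (22, 18, 4), (3, 23, 14),
    (15, 18, 8), (12, 23, 2), (14, 17, 10), (15, 0, 8), (3, 13, 14), (15, 12, 8), (22, 19, 10),
    (23, 17, 10), (23, 6, 22), (8, 20, 13), (16, 15, 19), (9, 21, 4), (19, 22, 18), (5, 1, 20),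
    (8, 12, 9), (21, 18, 9), (20, 23, 12), (21, 15, 18), (0, 5, 1), (7, 15, 12), (6, 1, 17),
    (12, 9, 23), (9, 3, 23), (16, 3, 14), (12, 21, 22), (1, 18, 4), (15, 16, 19), (17, 7, 15),
    (16, 10, 7), (15, 19, 5), (10, 17, 12), (22, 4, 11), (15, 21, 18), (15, 12, 21), (6, 21, 11)]

/-- Membership of a pair in an encoded set. -/
def memPair (K a t : ℕ) : Bool := K.testBit (24 * a + t)

/-- One application of the conjugation argument to the set `K` of pairs with a known relation. -/
def applySquare (K : ℕ) (q : ℕ × ℕ × ℕ) : ℕ :=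
  let a := q.1
  let t := q.2.1
  let u := q.2.2
  let b := conjIdx a t
  let a' := conjIdx a u
  let t' := conjIdx t u
  if t < 24 ∧ u < 24 ∧ memPair K t u ∧ conjIdx a' t' = conjIdx b u then
    if memPair K a u ∧ memPair K b u ∧ memPair K a' t' then bitInsert (24 * a + t) K
    else if memPair K a t ∧ memPair K b u ∧ memPair K a' t' then bitInsert (24 * a + u) K
    else if memPair K a t ∧ memPair K a u ∧ memPair K a' t' then bitInsert (24 * b + u) K
    else if memPair K a t ∧ memPair K a u ∧ memPair K b u then bitInsert (24 * a' + t') K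
    else K
  else K

/-- The encoded set of the pairs whose dual braid relation follows from `basePairs`; they turn out
to be the pairs `(a, t)` with `a t ≼ w`. -/
def dualPairs : ℕ :=
  squares.foldl applySquare (basePairs.foldr (fun p => bitInsert (24 * p.1 + p.2)) 0)

theorem DualBraidOn.dualBraid {τ : ℕ → G} {K a t : ℕ} (hK : DualBraidOn τ K) (ht : t < 24)
    (h : memPair K a t = true) : DualBraid τ a t := by
  have := hK _ h
  rwa [show (24 * a + t) / 24 = a by lia, show (24 * a + t) % 24 = t by lia] at this

theorem DualBraidOn.bitInsert {τ : ℕ → G} {K a t : ℕ} (hK : DualBraidOn τ K) (ht : t < 24)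
    (h : DualBraid τ a t) : DualBraidOn τ (bitInsert (24 * a + t) K) := by
  intro n hn
  rcases testBit_bitInsert hn with rfl | hn
  · rwa [show (24 * a + t) / 24 = a by lia, show (24 * a + t) % 24 = t by lia]
  · exact hK n hn

theorem DualBraidOn.applySquare {τ : ℕ → G} {K : ℕ} (hK : DualBraidOn τ K) (q : ℕ × ℕ × ℕ) :
    DualBraidOn τ (applySquare K q) := by
  obtain ⟨a, t, u⟩ := q
  have key {x y : ℕ} (hy : y < 24) (h : memPair K x y = true) :=
    (dualBraid_iff ..).1 (hK.dualBraid hy h)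
  simp only [F₄.applySquare]
  split_ifs with h1 h2 h3 h4 h5
  · obtain ⟨ht, hu, htu, hc⟩ := h1
    have h0 := key hu htu
    have hx := key hu h2.1
    have hy := key hu h2.2.1
    have hz := key (conjIdx_lt _ _) h2.2.2
    refine hK.bitInsert ht ((dualBraid_iff ..).2 ?_)
    rw [hc, hy, hx, h0] at hz
    have := congrArg (fun g => τ u * g * (τ u)⁻¹) hz
    simpa [mul_assoc] using this
  · obtain ⟨ht, hu, htu, hc⟩ := h1
    have h0 := key hu htu
    have ha := key ht h3.1
    have hy := key hu h3.2.1
    have hz := key (conjIdx_lt _ _) h3.2.2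
    refine hK.bitInsert hu ((dualBraid_iff ..).2 ?_)
    rw [hc, hy, ha, h0] at hz
    have := congrArg (fun g => (τ u)⁻¹ * τ t * τ u * g * ((τ u)⁻¹ * τ t * τ u)⁻¹) hz
    simpa [mul_assoc] using this.symm
  · obtain ⟨ht, hu, htu, hc⟩ := h1
    have h0 := key hu htu
    have ha := key ht h4.1
    have hx := key hu h4.2.1
    have hz := key (conjIdx_lt _ _) h4.2.2
    refine hK.bitInsert hu ((dualBraid_iff ..).2 ?_)
    rw [hc, hx, h0] at hz
    rw [hz, ha]
    simp [mul_assoc]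
  · obtain ⟨ht, hu, htu, hc⟩ := h1
    have h0 := key hu htu
    have ha := key ht h5.1
    have hx := key hu h5.2.1
    have hy := key hu h5.2.2
    refine hK.bitInsert (conjIdx_lt _ _) ((dualBraid_iff ..).2 ?_)
    rw [hc, hy, hx, h0, ha]
    simp [mul_assoc]
  · exact hK
  · exact hK

/-- The dual braid relations of `basePairs` imply those of all products `a t ≼ w`. -/
theorem dualBraidOn_dualPairs {τ : ℕ → G} (h : ∀ p ∈ basePairs, DualBraid τ p.1 p.2) :
    DualBraidOn τ dualPairs := by
  have hbase : ∀ l : List (ℕ × ℕ), (∀ p ∈ l, p.2 < 24 ∧ DualBraid τ p.1 p.2) →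
      DualBraidOn τ (l.foldr (fun p => bitInsert (24 * p.1 + p.2)) 0) := by
    intro l
    induction l with
    | nil => intro _ n hn; simp at hn
    | cons p l ih =>
      intro hl
      have hp := hl p List.mem_cons_self
      exact (ih fun q hq => hl q (List.mem_cons_of_mem _ hq)).bitInsert hp.1 hp.2
  have hfold : ∀ (l : List (ℕ × ℕ × ℕ)) (K : ℕ), DualBraidOn τ K →
      DualBraidOn τ (l.foldl F₄.applySquare K) := by
    intro l
    induction l with
    | nil => exact fun _ hK => hK
    | cons q l ih => exact fun K hK => ih _ (hK.applySquare q)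
  have hlt : ∀ p ∈ basePairs, p.2 < 24 := by decide
  exact hfold _ _ (hbase _ fun p hp => ⟨hlt p hp, h p hp⟩)

/-! ### Hurwitz moves -/

/-- The code of a quadruple of numbers below 24. -/
def quadCode (a b c d : ℕ) : ℕ := ((24 * a + b) * 24 + c) * 24 + d

/-- The product `τ a * τ b * τ c * τ d` belonging to the code of `(a, b, c, d)`. -/
def quadProd (τ : ℕ → G) (n : ℕ) : G :=
  τ (n / 13824) * τ (n / 576 % 24) * τ (n / 24 % 24) * τ (n % 24)

theorem quadProd_quadCode (τ : ℕ → G) {a b c d : ℕ} (hb : b < 24) (hc : c < 24) (hd : d < 24) :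
    quadProd τ (quadCode a b c d) = τ a * τ b * τ c * τ d := by
  rw [quadProd, quadCode]
  congr <;> lia

/-- The Hurwitz moves on a quadruple, those which replace adjacent entries `a, t` with a known dual
braid relation by `t, t a t`. -/
def hurwitzMoves (n : ℕ) : List ℕ :=
  let a := n / 13824
  let b := n / 576 % 24
  let c := n / 24 % 24
  let d := n % 24
  (if memPair dualPairs a b then [quadCode b (conjIdx a b) c d] else []) ++
  ((if memPair dualPairs b c then [quadCode a c (conjIdx b c) d] else []) ++
  (if memPair dualPairs c d then [quadCode a b d (conjIdx c d)] else []))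

/-- Depth-first search of a Hurwitz orbit: the first argument bounds the number of steps, `todo` are
the codes still to be visited, and the result is a set of codes stored as binary digits. -/
def hurwitzSearch : ℕ → List ℕ → ℕ → ℕ
  | 0, _, visited => visited
  | _ + 1, [], visited => visited
  | k + 1, n :: todo, visited =>
    if visited.testBit n then hurwitzSearch k todo visited
    else hurwitzSearch k (hurwitzMoves n ++ todo) (bitInsert n visited)

/-- The set of codes of the Hurwitz orbit of the decomposition `w = s₁ s₃ s₂ s₄`. It has 648
elements, each of which puts at most three codes on the agenda. -/
def hurwitzOrbit : ℕ := hurwitzSearch 2600 [quadCode 0 2 1 3] 0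

theorem quadProd_of_mem_hurwitzMoves {τ : ℕ → G} (h : DualBraidOn τ dualPairs) {n m : ℕ}
    (hm : m ∈ hurwitzMoves n) : quadProd τ m = quadProd τ n := by
  have hlt : ∀ k : ℕ, k % 24 < 24 := fun k => Nat.mod_lt _ (by norm_num)
  simp only [hurwitzMoves, List.mem_append] at hm
  rcases hm with hm | hm | hm <;> split_ifs at hm with hp <;>
    simp only [List.mem_singleton, List.not_mem_nil] at hm <;> subst hm <;>
    have := h.dualBraid (hlt _) hp <;> rw [DualBraid] at this
  · rw [quadProd_quadCode τ (conjIdx_lt _ _) (hlt _) (hlt _), ← this, quadProd]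
  · rw [quadProd_quadCode τ (hlt _) (conjIdx_lt _ _) (hlt _), mul_assoc (τ _) (τ (n / 24 % 24)),
      ← this, ← mul_assoc, quadProd]
  · rw [quadProd_quadCode τ (hlt _) (hlt _) (conjIdx_lt _ _), mul_assoc _ (τ (n % 24)), ← this,
      ← mul_assoc, quadProd]

theorem quadProd_of_mem_hurwitzSearch {τ : ℕ → G} (h : DualBraidOn τ dualPairs) {g : G} :
    ∀ (k : ℕ) (todo : List ℕ) (visited : ℕ), (∀ n ∈ todo, quadProd τ n = g) →
      (∀ n, visited.testBit n = true → quadProd τ n = g) →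
      ∀ n, (hurwitzSearch k todo visited).testBit n = true → quadProd τ n = g := by
  intro k
  induction k with
  | zero => exact fun _ _ _ hv => hv
  | succ k ih =>
    rintro (_ | ⟨n, todo⟩) visited ht hv
    · exact hv
    · rw [hurwitzSearch]
      have hn := ht n List.mem_cons_self
      have ht' : ∀ m ∈ todo, quadProd τ m = g := fun m hm => ht m (List.mem_cons_of_mem _ hm)
      split_ifs
      · exact ih _ _ ht' hv
      · refine ih _ _ (fun m hm => ?_) (fun m hm => ?_)
        · rcases List.mem_append.1 hm with hm | hm
          exacts [(quadProd_of_mem_hurwitzMoves h hm).trans hn, ht' m hm]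
        · rcases testBit_bitInsert hm with rfl | hm
          exacts [hn, hv m hm]

/-- All decompositions in the Hurwitz orbit have the same product in a group satisfying the
dual braid relations. -/
theorem mul_eq_of_mem_hurwitzOrbit {τ : ℕ → G} (h : ∀ p ∈ basePairs, DualBraid τ p.1 p.2)
    {a b c d : ℕ} (hb : b < 24) (hc : c < 24) (hd : d < 24)
    (hx : hurwitzOrbit.testBit (quadCode a b c d) = true) :
    τ a * τ b * τ c * τ d = τ 0 * τ 2 * τ 1 * τ 3 := by
  rw [← quadProd_quadCode τ hb hc hd, ← quadProd_quadCode τ (a := 0) (b := 2) (c := 1) (d := 3)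
    (by norm_num) (by norm_num) (by norm_num)]
  exact quadProd_of_mem_hurwitzSearch (dualBraidOn_dualPairs h) _ _ _ (by simp) (by simp) _ hx

end DualBraid

/-! ### Normal forms in the Coxeter group -/

/-- `transversal k` lists reduced words for the representatives of the left cosets of the parabolic
subgroup `⟨s₀, …, s_{k-1}⟩` in `⟨s₀, …, s_k⟩`, of index 2, 3, 8 and 24 for `k = 0, 1, 2, 3`. -/
def transversal : ℕ → List (List (Fin 4))
  | 0 => [
    [], [0]]
  | 1 => [
    [], [1], [0, 1]]
  | 2 => [
    [], [2], [1, 2], [0, 1, 2], [2, 1, 2], [2, 0, 1, 2], [1, 2, 0, 1, 2], [2, 1, 2, 0, 1, 2]]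
  | 3 => [
    [], [3], [2, 3], [1, 2, 3], [0, 1, 2, 3], [2, 1, 2, 3], [2, 0, 1, 2, 3], [3, 2, 1, 2, 3],
    [1, 2, 0, 1, 2, 3], [3, 2, 0, 1, 2, 3], [2, 1, 2, 0, 1, 2, 3], [3, 1, 2, 0, 1, 2, 3],
    [3, 2, 1, 2, 0, 1, 2, 3], [2, 3, 1, 2, 0, 1, 2, 3], [2, 3, 2, 1, 2, 0, 1, 2, 3],
    [1, 2, 3, 1, 2, 0, 1, 2, 3], [1, 2, 3, 2, 1, 2, 0, 1, 2, 3], [0, 1, 2, 3, 1, 2, 0, 1, 2, 3],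
    [0, 1, 2, 3, 2, 1, 2, 0, 1, 2, 3], [2, 1, 2, 3, 2, 1, 2, 0, 1, 2, 3],
    [2, 0, 1, 2, 3, 2, 1, 2, 0, 1, 2, 3], [1, 2, 0, 1, 2, 3, 2, 1, 2, 0, 1, 2, 3],
    [2, 1, 2, 0, 1, 2, 3, 2, 1, 2, 0, 1, 2, 3], [3, 2, 1, 2, 0, 1, 2, 3, 2, 1, 2, 0, 1, 2, 3]]
  | _ => []

/-- The order of the deductions in the coset enumeration: `(i, m, j)` stands for the deduction of
the image under `sᵢ` of the `j`-th coset from the relation `(sᵢ sₘ) ^ M i m = 1`. -/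
def cosetDeductions : ℕ → List (Fin 4 × Fin 4 × ℕ)
  | 0 => []
  | 1 => [
    (1, 0, 2)]
  | 2 => [
    (0, 2, 1), (1, 0, 3), (0, 2, 4), (1, 2, 4), (0, 1, 6), (0, 2, 7), (1, 2, 7)]
  | 3 => [
    (0, 3, 1), (1, 3, 1), (0, 2, 2), (3, 2, 2), (3, 1, 3), (1, 0, 4), (3, 0, 4), (0, 2, 5),
    (1, 2, 5), (0, 3, 7), (1, 3, 7), (2, 3, 7), (0, 1, 8), (1, 3, 9), (2, 0, 9), (0, 2, 10),
    (1, 2, 10), (0, 1, 11), (0, 3, 12), (1, 3, 12), (0, 2, 13), (3, 2, 13), (0, 2, 14),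
    (2, 1, 15), (3, 1, 15), (1, 0, 17), (2, 0, 17), (3, 0, 17), (1, 0, 18), (0, 2, 19),
    (1, 2, 19), (3, 2, 19), (3, 0, 20), (0, 1, 21), (3, 1, 21), (0, 2, 22), (1, 2, 22),
    (0, 3, 23), (1, 3, 23), (2, 3, 23)]
  | _ => []

/-- The target of the edge of colour `i` at the vertex `j` in a partial coset graph; the entry
`(i, j, q)` of the list stands for the edge of colour `i` from `j` to `q`. -/
def edgeTarget (E : List (Fin 4 × ℕ × ℕ)) (i : Fin 4) (j : ℕ) : Option ℕ :=
  (E.find? fun e => e.1 == i && e.2.1 == j).map fun e => e.2.2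

/-- Follow `n` times an edge of colour `i` and then one of colour `m`. -/
def edgePath (E : List (Fin 4 × ℕ × ℕ)) (i m : Fin 4) : ℕ → ℕ → Option ℕ
  | 0, q => some q
  | n + 1, q => (edgeTarget E i q).bind fun q' => (edgeTarget E m q').bind (edgePath E i m n)

/-- The edge of colour `i` at `j` joins `j` to the end of the path with the `2 * M i m - 1` colours
`m, i, m, …, m`. -/
def deduceEdge (E : List (Fin 4 × ℕ × ℕ)) (x : Fin 4 × Fin 4 × ℕ) : List (Fin 4 × ℕ × ℕ) :=
  match (edgeTarget E x.2.1 x.2.2).bind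
      (edgePath E x.1 x.2.1 (CoxeterMatrix.F₄.M x.1 x.2.1 - 1)) with
  | some q => (x.1, x.2.2, q) :: (x.1, q, x.2.2) :: E
  | none => E

/-- The edges of the coset graph that are known at the outset: the loops at the trivial coset, and
the edges along which the representatives are obtained from one another. -/
def initialEdges (k : ℕ) : List (Fin 4 × ℕ × ℕ) :=
  ((List.finRange 4).filter (fun i => i.val < k)).map (fun i => (i, 0, 0)) ++
  (List.range (transversal k).length).flatMap fun q =>
    match (transversal k).getD q [] with
    | [] => []
    | i :: x =>
      let j := (transversal k).idxOf x
      if (transversal k).getD j [] = x then [(i, j, q), (i, q, j)] else []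

/-- All edges of the coset graph. -/
def cosetEdges (k : ℕ) : List (Fin 4 × ℕ × ℕ) :=
  (cosetDeductions k).foldl deduceEdge (initialEdges k)

/-- The coset enumeration closes: every edge of the coset graph is known. -/
theorem cosetEdges_complete : ∀ k < 4, (transversal k).getD 0 [] = [] ∧
    ∀ i : Fin 4, i.val < k + 1 → ∀ j < (transversal k).length,
      ∃ q < (transversal k).length, edgeTarget (cosetEdges k) i j = some q := by
  decide +kernel

section Transversal

variable {W : Type*} [Group W] (cs : CoxeterSystem CoxeterMatrix.F₄ W)

/-- The edges in `E` are correct for the action of `W` on a set with marked points `p`. -/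
def EdgesCorrect {X : Type*} [MulAction W X] (p : ℕ → X) (E : List (Fin 4 × ℕ × ℕ)) : Prop :=
  ∀ e ∈ E, cs.simple e.1 • p e.2.1 = p e.2.2

variable {cs} in
theorem EdgesCorrect.smul_eq {X : Type*} [MulAction W X] {p : ℕ → X} {E : List (Fin 4 × ℕ × ℕ)}
    (hE : EdgesCorrect cs p E) {i : Fin 4} {j q : ℕ} (h : edgeTarget E i j = some q) :
    cs.simple i • p j = p q := by
  rw [edgeTarget, Option.map_eq_some_iff] at h
  obtain ⟨e, he, rfl⟩ := h
  have h1 := List.find?_some he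
  simp only [Bool.and_eq_true, beq_iff_eq] at h1
  rw [← h1.1, ← h1.2]
  exact hE e (List.mem_of_find?_eq_some he)

variable {cs} in
theorem EdgesCorrect.smul_eq_path {X : Type*} [MulAction W X] {p : ℕ → X}
    {E : List (Fin 4 × ℕ × ℕ)} (hE : EdgesCorrect cs p E) {i m : Fin 4} :
    ∀ {n j q : ℕ}, edgePath E i m n j = some q →
      (cs.simple m * cs.simple i) ^ n • p j = p q
  | 0, j, q, h => by simp_all [edgePath]
  | n + 1, j, q, h => by
    rw [edgePath, Option.bind_eq_some_iff] at h
    obtain ⟨q', h1, h⟩ := h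
    rw [Option.bind_eq_some_iff] at h
    obtain ⟨q'', h2, h⟩ := h
    rw [pow_succ, mul_smul, mul_smul, hE.smul_eq h1, hE.smul_eq h2, hE.smul_eq_path h]

theorem simple_eq_pow_mul (i m : Fin 4) :
    cs.simple i =
      (cs.simple m * cs.simple i) ^ (CoxeterMatrix.F₄.M i m - 1) * cs.simple m := by
  have h := cs.simple_mul_simple_pow m i
  have h0 : ∀ i m : Fin 4, CoxeterMatrix.F₄.M m i = CoxeterMatrix.F₄.M i m - 1 + 1 := by decide
  rw [show CoxeterMatrix.F₄ m i = CoxeterMatrix.F₄.M m i from rfl, h0 i m, pow_succ] at h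
  rw [eq_inv_of_mul_eq_one_left h]
  simp

variable {cs} in
theorem EdgesCorrect.deduceEdge {X : Type*} [MulAction W X] {p : ℕ → X}
    {E : List (Fin 4 × ℕ × ℕ)} (hE : EdgesCorrect cs p E) (x : Fin 4 × Fin 4 × ℕ) :
    EdgesCorrect cs p (deduceEdge E x) := by
  rw [F₄.deduceEdge]
  split
  · rename_i q hq
    rw [Option.bind_eq_some_iff] at hq
    obtain ⟨q', h1, h2⟩ := hq
    have h : cs.simple x.1 • p x.2.2 = p q := by
      rw [simple_eq_pow_mul cs x.1 x.2.1, mul_smul, hE.smul_eq h1, hE.smul_eq_path h2]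
    intro e he
    rcases List.mem_cons.1 he with rfl | he
    · exact h
    rcases List.mem_cons.1 he with rfl | he
    · change cs.simple x.1 • p q = p x.2.2
      rw [← h, ← mul_smul, cs.simple_mul_simple_self, one_smul]
    · exact hE e he
  · exact hE

/-- The standard parabolic subgroup generated by the first `k` simple reflections. -/
def parabolic (k : ℕ) : Subgroup W :=
  Subgroup.closure {g | ∃ i : Fin 4, i.val < k ∧ cs.simple i = g}

theorem edgesCorrect_cosetEdges {k : ℕ} (hk : k < 4) :
    EdgesCorrect cs (fun j => (cs.wordProd ((transversal k).getD j []) : W ⧸ parabolic cs k))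
      (cosetEdges k) := by
  have hfold : ∀ (l : List (Fin 4 × Fin 4 × ℕ)) (E : List (Fin 4 × ℕ × ℕ)),
      EdgesCorrect cs (fun j => (cs.wordProd ((transversal k).getD j []) : W ⧸ parabolic cs k)) E →
      EdgesCorrect cs (fun j => (cs.wordProd ((transversal k).getD j []) : W ⧸ parabolic cs k))
        (l.foldl deduceEdge E) := by
    intro l
    induction l with
    | nil => exact fun _ h => h
    | cons x l ih => exact fun E hE => ih _ (hE.deduceEdge x)
  refine hfold _ _ fun e he => ?_
  rcases List.mem_append.1 he with he | he
  · obtain ⟨i, hi, rfl⟩ := List.mem_map.1 he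
    have hi : i.val < k := by simpa using hi
    have h0 := (cosetEdges_complete k hk).1
    simp only [h0, cs.wordProd_nil]
    change ((cs.simple i * 1 : W) : W ⧸ parabolic cs k) = (1 : W)
    rw [mul_one, QuotientGroup.eq]
    rw [cs.inv_simple, mul_one]
    exact Subgroup.subset_closure ⟨i, hi, rfl⟩
  · obtain ⟨q, -, he⟩ := List.mem_flatMap.1 he
    split at he
    · simp at he
    · rename_i i x hx
      simp only at he
      split_ifs at he with hj
      · have hq : cs.simple i • (cs.wordProd x : W ⧸ parabolic cs k) =
            (cs.wordProd ((transversal k).getD q []) : W ⧸ parabolic cs k) := by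
          rw [hx, cs.wordProd_cons]; rfl
        rcases List.mem_cons.1 he with rfl | he
        · simpa only [hj] using hq
        · rw [List.mem_singleton] at he
          subst he
          simp only [hj]
          rw [← hq, ← mul_smul, cs.simple_mul_simple_self, one_smul]
      · simp at he

theorem exists_transversal {k : ℕ} (hk : k < 4) {g : W} (hg : g ∈ parabolic cs (k + 1)) :
    ∃ x ∈ transversal k, ∃ h ∈ parabolic cs k, g = cs.wordProd x * h := by
  have hE := edgesCorrect_cosetEdges cs hk
  obtain ⟨h0, hc⟩ := cosetEdges_complete k hk
  have hlen : ∀ k < 4, 0 < (transversal k).length := by decide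
  have key : ∃ j < (transversal k).length,
      (g : W ⧸ parabolic cs k) = (cs.wordProd ((transversal k).getD j []) : W) := by
    have hs : ∀ i : Fin 4, i.val < k + 1 → ∀ g : W, (∃ j < (transversal k).length,
        (g : W ⧸ parabolic cs k) = (cs.wordProd ((transversal k).getD j []) : W)) →
        ∃ j < (transversal k).length, ((cs.simple i * g : W) : W ⧸ parabolic cs k) =
          (cs.wordProd ((transversal k).getD j []) : W) := by
      rintro i hi g ⟨j, hj, hg⟩
      obtain ⟨q, hq, hjq⟩ := hc i hi j hj
      refine ⟨q, hq, ?_⟩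
      rw [← hE.smul_eq hjq, ← hg]
      rfl
    induction hg using Subgroup.closure_induction_left with
    | one => exact ⟨0, hlen k hk, by rw [h0, cs.wordProd_nil]⟩
    | mul_left x hx y _ ih =>
      obtain ⟨i, hi, rfl⟩ := hx
      exact hs i hi y ih
    | inv_mul_cancel x hx y _ ih =>
      obtain ⟨i, hi, rfl⟩ := hx
      rw [cs.inv_simple]
      exact hs i hi y ih
  obtain ⟨j, hj, hgj⟩ := key
  refine ⟨(transversal k).getD j [], ?_, (cs.wordProd ((transversal k).getD j []))⁻¹ * g,
    QuotientGroup.eq.1 hgj.symm, by simp⟩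
  rw [List.getD_eq_getElem _ _ hj]
  exact List.getElem_mem hj

/-- Words representing all elements of the Coxeter group (and, as it turns out, each of the 1152
elements once). -/
def normalWords : List (List (Fin 4)) :=
  (transversal 3).flatMap fun x₃ => (transversal 2).flatMap fun x₂ =>
    (transversal 1).flatMap fun x₁ => (transversal 0).map fun x₀ => x₃ ++ (x₂ ++ (x₁ ++ x₀))

theorem exists_normalWord (g : W) : ∃ x ∈ normalWords, cs.wordProd x = g := by
  have hg : g ∈ parabolic cs (3 + 1) := by
    have : parabolic cs 4 = ⊤ := by
      rw [← cs.subgroup_closure_range_simple, parabolic]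
      congr 1
      ext x
      simp
    rw [this]
    trivial
  obtain ⟨x₃, hx₃, h₃, hh₃, rfl⟩ := exists_transversal cs (by norm_num) hg
  obtain ⟨x₂, hx₂, h₂, hh₂, rfl⟩ := exists_transversal cs (k := 2) (by norm_num) hh₃
  obtain ⟨x₁, hx₁, h₁, hh₁, rfl⟩ := exists_transversal cs (k := 1) (by norm_num) hh₂
  obtain ⟨x₀, hx₀, h₀, hh₀, rfl⟩ := exists_transversal cs (k := 0) (by norm_num) hh₁
  have : h₀ = 1 := by
    simpa [parabolic] using hh₀
  refine ⟨x₃ ++ (x₂ ++ (x₁ ++ x₀)), ?_, by simp [cs.wordProd_append, this]⟩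
  simp only [normalWords, List.mem_flatMap, List.mem_map]
  exact ⟨x₃, hx₃, x₂, hx₂, x₁, hx₁, x₀, hx₀, rfl⟩

end Transversal

/-! ### The reflection representation over the integers -/

/-- The Cartan matrix of `F₄`. -/
def cartan : Matrix (Fin 4) (Fin 4) ℤ :=
  !![2, -1, 0, 0;
     -1, 2, -2, 0;
     0, -1, 2, -1;
     0, 0, -1, 2]

/-- The matrix of the simple reflection `sᵢ` in the basis of fundamental weights; it sends a weight
`v` to `v - vᵢ αᵢ`, where the simple root `αᵢ` is the `i`-th row of the Cartan matrix. -/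
def simpleMatrix (i : Fin 4) : Matrix (Fin 4) (Fin 4) ℤ :=
  1 - Matrix.of fun j k => if k = i then cartan i j else 0

theorem simpleMatrix_isLiftable : CoxeterMatrix.F₄.IsLiftable simpleMatrix := by
  unfold CoxeterMatrix.IsLiftable
  decide +kernel

/-- Integral weights in the basis of fundamental weights. -/
abbrev Weight : Type := ℤ × ℤ × ℤ × ℤ

/-- A weight as a vector. -/
def Weight.toFun (v : Weight) : Fin 4 → ℤ := ![v.1, v.2.1, v.2.2.1, v.2.2.2]

theorem Weight.toFun_injective : Function.Injective Weight.toFun := by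
  rintro ⟨a, b, c, d⟩ ⟨a', b', c', d'⟩ h
  have h0 := congrFun h 0
  have h1 := congrFun h 1
  have h2 := congrFun h 2
  have h3 := congrFun h 3
  simp only [toFun, Matrix.cons_val] at h0 h1 h2 h3
  rw [h0, h1, h2, h3]

/-- The action of a simple reflection on weights. -/
def simpleAct : Fin 4 → Weight → Weight
  | 0, (a, b, c, d) => (-a, a + b, c, d)
  | 1, (a, b, c, d) => (a + b, -b, 2 * b + c, d)
  | 2, (a, b, c, d) => (a, b + c, -c, c + d)
  | 3, (a, b, c, d) => (a, b, c + d, -d)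

/-- The action of a word in the simple reflections on weights. -/
def wordAct (x : List (Fin 4)) (v : Weight) : Weight := x.foldr simpleAct v

/-- The sum of the fundamental weights. -/
def weylVector : Weight := (1, 1, 1, 1)

/-- The position of the element represented by a word in the regular orbit of the Weyl vector. -/
def position (x : List (Fin 4)) : Weight := wordAct x weylVector

section Representation

variable {W : Type*} [Group W] (cs : CoxeterSystem CoxeterMatrix.F₄ W)

/-- The reflection representation, in the basis of fundamental weights. -/
noncomputable def weightRep : W →* Matrix (Fin 4) (Fin 4) ℤ :=
  cs.lift ⟨simpleMatrix, simpleMatrix_isLiftable⟩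

theorem weightRep_simple (i : Fin 4) : weightRep cs (cs.simple i) = simpleMatrix i :=
  cs.lift_apply_simple simpleMatrix_isLiftable i

theorem simpleMatrix_mulVec (i : Fin 4) (v : Weight) :
    (simpleMatrix i).mulVec v.toFun = (simpleAct i v).toFun := by
  obtain ⟨a, b, c, d⟩ := v
  fin_cases i <;> ext j <;> fin_cases j <;>
    simp [simpleMatrix, cartan, Weight.toFun, simpleAct, Matrix.mulVec, dotProduct,
      Fin.sum_univ_four, Matrix.one_apply]

theorem weightRep_wordProd (x : List (Fin 4)) (v : Weight) :
    (weightRep cs (cs.wordProd x)).mulVec v.toFun = (wordAct x v).toFun := by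
  induction x with
  | nil => simp [wordAct]
  | cons i x ih =>
    rw [cs.wordProd_cons, map_mul, ← Matrix.mulVec_mulVec, ih, weightRep_simple,
      simpleMatrix_mulVec]
    rfl

/-- Among the normal forms, the empty word alone fixes the Weyl vector. -/
theorem eq_nil_of_position_eq :
    normalWords.all (fun x => position x != weylVector || x.isEmpty) = true := by
  decide +kernel

/-- The stabilizer of the Weyl vector is trivial; hence equality in the Coxeter group can be tested
on positions. -/
theorem wordProd_eq_iff (x y : List (Fin 4)) :
    cs.wordProd x = cs.wordProd y ↔ position x = position y := by
  constructor
  · intro h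
    have hx := weightRep_wordProd cs x weylVector
    rw [h, weightRep_wordProd] at hx
    exact (Weight.toFun_injective hx).symm
  · intro h
    obtain ⟨n, hn, hn'⟩ := exists_normalWord cs ((cs.wordProd y)⁻¹ * cs.wordProd x)
    have hpos : position n = weylVector := by
      apply Weight.toFun_injective
      rw [position, ← weightRep_wordProd cs, hn', map_mul, ← Matrix.mulVec_mulVec,
        weightRep_wordProd, ← position, h, position, ← weightRep_wordProd cs y,
        Matrix.mulVec_mulVec, ← map_mul, inv_mul_cancel, map_one, Matrix.one_mulVec]
    have := List.all_eq_true.1 eq_nil_of_position_eq n hn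
    simp only [hpos, bne_self_eq_false, Bool.false_or, List.isEmpty_iff] at this
    rw [this, cs.wordProd_nil] at hn'
    exact (inv_mul_eq_one.1 hn'.symm).symm

/-! ### The reflections -/

/-- Palindromic words for the 24 reflections, numbered as in `conjTable`. -/
def reflectionWords : List (List (Fin 4)) :=
  [
    [0], [3, 2, 1, 0, 1, 2, 3], [3, 2, 3], [2, 3, 1, 2, 1, 3, 2], [3, 2, 1, 2, 3], [1, 2, 1],
    [2, 3, 1, 2, 1, 0, 1, 2, 1, 3, 2], [2, 3, 0, 1, 2, 1, 0, 3, 2], [3, 0, 1, 2, 1, 0, 3],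
    [1, 0, 1], [1], [3, 2, 1, 2, 3, 0, 1, 2, 1, 0, 3, 2, 1, 2, 3], [1, 2, 1, 0, 1, 2, 1],
    [3, 1, 2, 1, 0, 1, 2, 1, 3], [1, 2, 3, 1, 2, 1, 0, 1, 2, 1, 3, 2, 1],
    [0, 1, 2, 3, 1, 2, 1, 0, 1, 2, 1, 3, 2, 1, 0], [3, 1, 2, 1, 3],
    [2, 1, 2, 3, 0, 1, 2, 1, 0, 3, 2, 1, 2], [0, 1, 2, 1, 0], [1, 2, 3, 0, 1, 2, 1, 0, 3, 2, 1],
    [2, 1, 2], [3], [2, 1, 0, 1, 2], [2]]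

/-- The word of the reflection number `k`. -/
def reflectionWord (k : ℕ) : List (Fin 4) := reflectionWords.getD k []

/-- The reflection number `k`. -/
def refl (k : ℕ) : W := cs.wordProd (reflectionWord k)

theorem isReflection_refl {k : ℕ} (hk : k < 24) : cs.IsReflection (refl cs k) := by
  have key : ∀ k < 24, ∃ i : Fin 4,
      reflectionWord k = (reflectionWord k).take ((reflectionWord k).length / 2) ++
        i :: ((reflectionWord k).take ((reflectionWord k).length / 2)).reverse := by
    decide +kernel
  obtain ⟨i, hi⟩ := key k hk
  refine ⟨cs.wordProd ((reflectionWord k).take ((reflectionWord k).length / 2)), i, ?_⟩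
  rw [refl, hi, cs.wordProd_append, cs.wordProd_cons, cs.wordProd_reverse, ← hi, mul_assoc]

theorem exists_refl_eq {t : W} (ht : cs.IsReflection t) : ∃ k < 24, refl cs k = t := by
  have h0 : ∀ i : Fin 4, ∃ k < 24, position (reflectionWord k) = position [i] := by
    decide +kernel
  have h1 : ∀ i : Fin 4, ∀ k < 24, ∃ l < 24,
      position (reflectionWord l) = position (i :: (reflectionWord k ++ [i])) := by
    decide +kernel
  obtain ⟨g, i, rfl⟩ := ht
  induction g using cs.simple_induction_left with
  | one =>
    obtain ⟨k, hk, h⟩ := h0 i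
    exact ⟨k, hk, by simpa [refl] using (wordProd_eq_iff cs _ _).2 h⟩
  | mul_simple_left g j ih =>
    obtain ⟨k, hk, h⟩ := ih
    obtain ⟨l, hl, h'⟩ := h1 j k hk
    refine ⟨l, hl, ((wordProd_eq_iff cs _ _).2 h').trans ?_⟩
    rw [cs.wordProd_cons, cs.wordProd_append, ← refl, h, cs.wordProd_singleton, mul_inv_rev,
      cs.inv_simple]
    simp only [mul_assoc]

end Representation

/-! ### Fixed vectors of products of reflections -/

section FixedVectors

variable {W : Type*} [Group W] (cs : CoxeterSystem CoxeterMatrix.F₄ W)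
variable (K : Type*) [Field K]

/-- The reflection representation with coefficients in a field `K`. -/
noncomputable def fieldRep : W →* Matrix (Fin 4) (Fin 4) K :=
  ((Int.castRingHom K).mapMatrix : Matrix (Fin 4) (Fin 4) ℤ →+* _).toMonoidHom.comp (weightRep cs)

/-- The simple roots with coefficients in `K`. -/
def simpleRoot (i j : Fin 4) : K := (cartan i j : K)

theorem fieldRep_simple_mulVec (i : Fin 4) (v : Fin 4 → K) :
    (fieldRep cs K (cs.simple i)).mulVec v = v - v i • simpleRoot K i := by
  have h : fieldRep cs K (cs.simple i) = (simpleMatrix i).map (Int.castRingHom K) := by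
    rw [← weightRep_simple cs i]; rfl
  rw [h]
  ext j
  have : ∀ k, ((simpleMatrix i).map (Int.castRingHom K)) j k =
      (1 : Matrix (Fin 4) (Fin 4) K) j k - if k = i then simpleRoot K i j else 0 := by
    intro k
    simp only [simpleMatrix, Matrix.map_apply, Matrix.sub_apply, Matrix.of_apply, map_sub,
      Matrix.one_apply, simpleRoot]
    split_ifs <;> simp
  simp only [Matrix.mulVec, dotProduct, this, sub_mul, Finset.sum_sub_distrib, ite_mul, zero_mul,
    Finset.sum_ite_eq', Finset.mem_univ, if_true, Matrix.one_apply, one_mul, Finset.sum_ite_eq,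
    Pi.sub_apply, Pi.smul_apply, smul_eq_mul]
  ring

variable {K}

theorem exists_root {t : W} (ht : cs.IsReflection t) : ∃ β : Fin 4 → K, ∀ v : Fin 4 → K,
    ∃ a : K, v - (fieldRep cs K t).mulVec v = a • β := by
  obtain ⟨g, i, rfl⟩ := ht
  refine ⟨(fieldRep cs K g).mulVec (simpleRoot K i), fun v =>
    ⟨(fieldRep cs K g⁻¹).mulVec v i, ?_⟩⟩
  rw [map_mul, map_mul, ← Matrix.mulVec_mulVec, ← Matrix.mulVec_mulVec, fieldRep_simple_mulVec,
    Matrix.mulVec_sub, Matrix.mulVec_mulVec, ← map_mul, mul_inv_cancel, map_one,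
    Matrix.one_mulVec, sub_sub_cancel, Matrix.mulVec_smul]

theorem sub_mulVec_mem_of_mem_closure {T : Set W} {S : Submodule K (Fin 4 → K)}
    (hS : ∀ t ∈ T, ∀ v, v - (fieldRep cs K t).mulVec v ∈ S) {g : W}
    (hg : g ∈ Subgroup.closure T) : ∀ v, v - (fieldRep cs K g).mulVec v ∈ S := by
  induction hg using Subgroup.closure_induction with
  | mem t ht => exact hS t ht
  | one => intro v; simp
  | mul x y _ _ hx hy =>
    intro v
    rw [map_mul, ← Matrix.mulVec_mulVec]
    have := S.add_mem (hy v) (hx ((fieldRep cs K y).mulVec v))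
    rwa [sub_add_sub_cancel] at this
  | inv x _ hx =>
    intro v
    have := S.neg_mem (hx ((fieldRep cs K x⁻¹).mulVec v))
    rwa [Matrix.mulVec_mulVec, ← map_mul, mul_inv_cancel, map_one, Matrix.one_mulVec,
      neg_sub] at this

/-- A product of `k` reflections, and any element of the group generated by them, moves every vector
by an element of a fixed subspace of dimension at most `k`. -/
theorem exists_submodule_of_reflections (K : Type*) [Field K] (l : List W)
    (hl : ∀ t ∈ l, cs.IsReflection t) : ∃ S : Submodule K (Fin 4 → K),
      Module.finrank K S ≤ l.length ∧
      ∀ g ∈ Subgroup.closure {t | t ∈ l}, ∀ v, v - (fieldRep cs K g).mulVec v ∈ S := by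
  suffices h : ∃ S : Submodule K (Fin 4 → K), Module.finrank K S ≤ l.length ∧
      ∀ t ∈ l, ∀ v, v - (fieldRep cs K t).mulVec v ∈ S by
    obtain ⟨S, h1, h2⟩ := h
    exact ⟨S, h1, fun g hg => sub_mulVec_mem_of_mem_closure cs h2 hg⟩
  induction l with
  | nil => exact ⟨⊥, by simp, by simp⟩
  | cons t l ih =>
    obtain ⟨S, h1, h2⟩ := ih fun t ht => hl t (List.mem_cons_of_mem _ ht)
    obtain ⟨β, hβ⟩ := exists_root (K := K) cs (hl t List.mem_cons_self)
    refine ⟨S ⊔ Submodule.span K {β}, ?_, ?_⟩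
    · have h3 : Module.finrank K (Submodule.span K {β}) ≤ 1 := by
        simpa using finrank_span_le_card (R := K) ({β} : Set (Fin 4 → K))
      have := Submodule.finrank_add_le_finrank_add_finrank S (Submodule.span K {β})
      rw [List.length_cons]
      lia
    · intro t' ht' v
      rcases List.mem_cons.1 ht' with rfl | ht'
      · obtain ⟨a, ha⟩ := hβ v
        rw [ha]
        exact Submodule.mem_sup_right (Submodule.smul_mem _ _ (Submodule.mem_span_singleton_self β))
      · exact Submodule.mem_sup_left (h2 t' ht' v)

/-- The simple roots span: the determinant of the Cartan matrix of `F₄` is 1. -/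
theorem eq_top_of_simple {S : Submodule K (Fin 4 → K)}
    (hS : ∀ i (v : Fin 4 → K), v - (fieldRep cs K (cs.simple i)).mulVec v ∈ S) : S = ⊤ := by
  have hroot : ∀ i, simpleRoot K i ∈ S := fun i => by
    have := hS i (Pi.single i 1)
    rwa [fieldRep_simple_mulVec, sub_sub_cancel, Pi.single_eq_same, one_smul] at this
  have hinv : !![2, 3, 4, 2; 3, 6, 8, 4; 2, 4, 6, 3; 1, 2, 3, 2] * cartan = 1 := by decide
  rw [eq_top_iff, ← (Pi.basisFun K (Fin 4)).span_eq, Submodule.span_le]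
  rintro _ ⟨j, rfl⟩
  have : Pi.basisFun K (Fin 4) j = ∑ i,
      ((!![2, 3, 4, 2; 3, 6, 8, 4; 2, 4, 6, 3; 1, 2, 3, 2] j i : ℤ) : K) • simpleRoot K i := by
    ext k
    have h := congrArg (fun A => ((A j k : ℤ) : K)) hinv
    simp only [Matrix.mul_apply, Int.cast_sum, Int.cast_mul] at h
    simp only [Pi.basisFun_apply, Finset.sum_apply, Pi.smul_apply, smul_eq_mul, simpleRoot]
    rw [h, Matrix.one_apply, Pi.single_apply]
    rcases eq_or_ne j k with rfl | hjk
    · simp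
    · rw [if_neg hjk.symm, if_neg hjk, Int.cast_zero]
  rw [SetLike.mem_coe, this]
  exact S.sum_mem fun i _ => S.smul_mem _ (hroot i)

theorem eq_zero_of_simple {v : Fin 4 → K}
    (hv : ∀ i, (fieldRep cs K (cs.simple i)).mulVec v = v) : v = 0 := by
  have hne : ∀ i, simpleRoot K i ≠ 0 := by
    intro i h
    have hj : cartan i (![1, 0, 1, 2] i) = -1 := by
      fin_cases i <;> rfl
    have := congrFun h (![1, 0, 1, 2] i)
    rw [simpleRoot, hj] at this
    simp at this
  ext i
  have := hv i
  rw [fieldRep_simple_mulVec, sub_eq_self] at this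
  exact (smul_eq_zero.1 this).resolve_right (hne i)

theorem four_le_length_of_generates {l : List W} (hl : ∀ t ∈ l, cs.IsReflection t)
    (hgen : Subgroup.closure {t | t ∈ l} = ⊤) : 4 ≤ l.length := by
  obtain ⟨S, h1, h2⟩ := exists_submodule_of_reflections cs ℚ l hl
  rw [eq_top_of_simple cs fun i => h2 _ (hgen ▸ Subgroup.mem_top _), finrank_top,
    Module.finrank_fin_fun] at h1
  exact h1

/-- A product of four reflections that generate the group has no fixed vectors over any field: the
roots of the four reflections span, hence are linearly independent, so a fixed vector of the
product is fixed by each factor. -/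
theorem eq_zero_of_fixed {t₀ t₁ t₂ t₃ : W} (hl : ∀ t ∈ [t₀, t₁, t₂, t₃], cs.IsReflection t)
    (hgen : Subgroup.closure {t | t ∈ [t₀, t₁, t₂, t₃]} = ⊤) {v : Fin 4 → K}
    (hv : (fieldRep cs K (t₀ * t₁ * t₂ * t₃)).mulVec v = v) : v = 0 := by
  obtain ⟨β₀, h₀⟩ := exists_root (K := K) cs (hl t₀ (by simp))
  obtain ⟨β₁, h₁⟩ := exists_root (K := K) cs (hl t₁ (by simp))
  obtain ⟨β₂, h₂⟩ := exists_root (K := K) cs (hl t₂ (by simp))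
  obtain ⟨β₃, h₃⟩ := exists_root (K := K) cs (hl t₃ (by simp))
  have hspan : Submodule.span K (Set.range ![β₀, β₁, β₂, β₃]) = ⊤ := by
    have hβ : ∀ i, ![β₀, β₁, β₂, β₃] i ∈ Submodule.span K (Set.range ![β₀, β₁, β₂, β₃]) :=
      fun i => Submodule.subset_span ⟨i, rfl⟩
    refine eq_top_of_simple cs fun i => sub_mulVec_mem_of_mem_closure cs ?_
      (hgen ▸ Subgroup.mem_top _)
    intro t ht u
    simp only [Set.mem_ofPred_eq, List.mem_cons, List.not_mem_nil, or_false] at ht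
    rcases ht with rfl | rfl | rfl | rfl
    · obtain ⟨a, ha⟩ := h₀ u
      exact ha ▸ Submodule.smul_mem _ _ (hβ 0)
    · obtain ⟨a, ha⟩ := h₁ u
      exact ha ▸ Submodule.smul_mem _ _ (hβ 1)
    · obtain ⟨a, ha⟩ := h₂ u
      exact ha ▸ Submodule.smul_mem _ _ (hβ 2)
    · obtain ⟨a, ha⟩ := h₃ u
      exact ha ▸ Submodule.smul_mem _ _ (hβ 3)
  have hli : LinearIndependent K ![β₀, β₁, β₂, β₃] :=
    linearIndependent_of_top_le_span_of_card_eq_finrank hspan.ge (by simp)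
  -- Telescoping `v - t₀ t₁ t₂ t₃ v` writes it as a combination of the four roots.
  obtain ⟨a₃, ha₃⟩ := h₃ v
  obtain ⟨a₂, ha₂⟩ := h₂ ((fieldRep cs K t₃).mulVec v)
  obtain ⟨a₁, ha₁⟩ := h₁ ((fieldRep cs K t₂).mulVec ((fieldRep cs K t₃).mulVec v))
  obtain ⟨a₀, ha₀⟩ := h₀ ((fieldRep cs K t₁).mulVec ((fieldRep cs K t₂).mulVec
    ((fieldRep cs K t₃).mulVec v)))
  have hsum : ∑ i, ![a₀, a₁, a₂, a₃] i • ![β₀, β₁, β₂, β₃] i = 0 := by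
    simp only [map_mul, ← Matrix.mulVec_mulVec] at hv
    simp only [Fin.sum_univ_four, Matrix.cons_val]
    rw [← ha₀, ← ha₁, ← ha₂, ← ha₃, hv]
    abel
  have hz := Fintype.linearIndependent_iff.1 hli _ hsum
  have z₀ : a₀ = 0 := hz 0
  have z₁ : a₁ = 0 := hz 1
  have z₂ : a₂ = 0 := hz 2
  have z₃ : a₃ = 0 := hz 3
  rw [z₃, zero_smul, sub_eq_zero] at ha₃
  rw [z₂, zero_smul, sub_eq_zero, ← ha₃] at ha₂
  rw [z₁, zero_smul, sub_eq_zero, ← ha₃, ← ha₂] at ha₁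
  rw [z₀, zero_smul, sub_eq_zero, ← ha₃, ← ha₂, ← ha₁] at ha₀
  refine eq_zero_of_simple cs fun i => ?_
  have hfix : ∀ g ∈ Subgroup.closure {t | t ∈ [t₀, t₁, t₂, t₃]},
      (fieldRep cs K g).mulVec v = v := by
    intro g hg
    induction hg using Subgroup.closure_induction with
    | mem t ht =>
      simp only [Set.mem_ofPred_eq, List.mem_cons, List.not_mem_nil, or_false] at ht
      rcases ht with rfl | rfl | rfl | rfl
      exacts [ha₀.symm, ha₁.symm, ha₂.symm, ha₃.symm]
    | one => simp
    | mul x y _ _ hx hy => rw [map_mul, ← Matrix.mulVec_mulVec, hy, hx]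
    | inv x _ hx =>
      conv_lhs => rw [← hx]
      rw [Matrix.mulVec_mulVec, ← map_mul, inv_mul_cancel, map_one, Matrix.one_mulVec]
  exact hfix _ (hgen ▸ Subgroup.mem_top _)

/-- If four reflections generate the group, then no prime divides `det (w - 1)` for their
product `w`. -/
theorem not_dvd_det {t₀ t₁ t₂ t₃ : W} (hl : ∀ t ∈ [t₀, t₁, t₂, t₃], cs.IsReflection t)
    (hgen : Subgroup.closure {t | t ∈ [t₀, t₁, t₂, t₃]} = ⊤) (p : ℕ) [Fact p.Prime] :
    ¬ (p : ℤ) ∣ (weightRep cs (t₀ * t₁ * t₂ * t₃) - 1).det := by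
  intro h
  have hdet : ((Int.castRingHom (ZMod p)).mapMatrix
      (weightRep cs (t₀ * t₁ * t₂ * t₃) - 1)).det = 0 := by
    rw [← RingHom.map_det]
    exact (ZMod.intCast_zmod_eq_zero_iff_dvd _ _).2 h
  obtain ⟨v, hv, hv'⟩ := Matrix.exists_mulVec_eq_zero_iff.2 hdet
  refine hv (eq_zero_of_fixed (K := ZMod p) cs hl hgen ?_)
  rw [map_sub, map_one, Matrix.sub_mulVec, Matrix.one_mulVec, sub_eq_zero] at hv'
  exact hv'

end FixedVectors

/-! ### The conjugacy classes of quasi-Coxeter elements -/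

/-- The word `s₁ s₃ s₂ s₄` in the reflections spanning `F₄(a₁)`, as a word in the simple
reflections. -/
def carterWord : List (Fin 4) :=
  reflectionWord 0 ++ (reflectionWord 2 ++ (reflectionWord 1 ++ reflectionWord 3))

/-- The determinant of the matrix with rows `p, q, r, s`, by expansion along the first two rows. -/
def detWeights (p q r s : Weight) : ℤ :=
  let m (x y : ℤ × ℤ) : ℤ := x.1 * y.2 - x.2 * y.1
  let (p₀, p₁, p₂, p₃) := p
  let (q₀, q₁, q₂, q₃) := q
  let (r₀, r₁, r₂, r₃) := r
  let (s₀, s₁, s₂, s₃) := s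
  m (p₀, p₁) (q₀, q₁) * m (r₂, r₃) (s₂, s₃) - m (p₀, p₂) (q₀, q₂) * m (r₁, r₃) (s₁, s₃)
  + m (p₀, p₃) (q₀, q₃) * m (r₁, r₂) (s₁, s₂) + m (p₁, p₂) (q₁, q₂) * m (r₀, r₃) (s₀, s₃)
  - m (p₁, p₃) (q₁, q₃) * m (r₀, r₂) (s₀, s₂) + m (p₂, p₃) (q₂, q₃) * m (r₀, r₁) (s₀, s₁)

/-- The determinant of `w - 1` for the element `w` represented by the word `x`. -/
def fixDet (x : List (Fin 4)) : ℤ :=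
  detWeights (wordAct x (1, 0, 0, 0) - (1, 0, 0, 0)) (wordAct x (0, 1, 0, 0) - (0, 1, 0, 0))
    (wordAct x (0, 0, 1, 0) - (0, 0, 1, 0)) (wordAct x (0, 0, 0, 1) - (0, 0, 0, 1))

/-- Words for conjugates of the element represented by `c`, by the elements of the parabolic
subgroup of type `B₃` and by those of one of its cosets. They exhaust the conjugacy class if
`c` represents a Coxeter element or is `carterWord`. -/
def conjugateWords (c : List (Fin 4)) : List (List (Fin 4)) :=
  (transversal 2).flatMap fun x₂ => (transversal 1).flatMap fun x₁ => (transversal 0).flatMap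
    fun x₀ =>
      let u := x₂ ++ (x₁ ++ x₀)
      let u' := u ++ [3, 2, 1, 2, 0, 1, 2, 3]
      [u ++ (c ++ u.reverse), u' ++ (c ++ u'.reverse)]

/-- An element `w` for which neither 2 nor 3 divides `det (w - 1)` is a Coxeter element or conjugate
to `carterWord`. -/
theorem conjugateWords_check : normalWords.all (fun x =>
    let d := fixDet x
    d % 2 == 0 || d % 3 == 0
      || (conjugateWords [0, 1, 2, 3]).any (fun y => position y == position x)
      || (conjugateWords carterWord).any (fun y => position y == position x)) = true := by
  decide +kernel

/-- A numerical code of a weight. The summand `2 ^ 25` prevents the truncation of negative values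
for the small weights that occur. -/
def weightCode (v : Weight) : ℕ :=
  (((v.1 * 64 + v.2.1) * 64 + v.2.2.1) * 64 + v.2.2.2 + 2 ^ 25).toNat

/-- The word of a product of two reflections, encoded as `24 * a + b`. -/
def pairWord (n : ℕ) : List (Fin 4) := reflectionWord (n / 24) ++ reflectionWord (n % 24)

/-- The products of two reflections, sorted by the code of their position modulo `p`: the binary
digit number `576 * r + n` says that the pair number `n` has a position whose code is `r`
modulo `p`. -/
def pairTable (p : ℕ) : ℕ :=
  (List.range 576).foldr
    (fun n => bitInsert (576 * (weightCode (position (pairWord n)) % p) + n)) 0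

/-- The `n`-th block of 576 binary digits of `K`. -/
def digitBlock (K n : ℕ) : ℕ := (K >>> (576 * n)) % 2 ^ 576

/-- The set of pairs of reflections whose product may have the position `v`. The two moduli are
chosen so that there are no accidental coincidences in the searches below. -/
def pairCandidates (v : Weight) : ℕ :=
  let m := weightCode v
  digitBlock (pairTable 468) (m % 468) &&& digitBlock (pairTable 447) (m % 447)

/-- Every element of odd length becomes a product of two reflections on multiplication by a suitable
reflection. -/
theorem odd_check : normalWords.all (fun x => x.length % 2 == 0 ||
    let p := position x
    (List.range 24).any fun k =>
      let v := wordAct (reflectionWord k) p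
      let n := (pairCandidates v).log2
      n < 576 && position (pairWord n) == v) = true := by
  decide +kernel

section Classification

variable {W : Type*} [Group W] (cs : CoxeterSystem CoxeterMatrix.F₄ W)

theorem position_append (x y : List (Fin 4)) : position (x ++ y) = wordAct x (position y) := by
  simp [position, wordAct, List.foldr_append]

theorem wordProd_pairWord (n : ℕ) :
    cs.wordProd (pairWord n) = refl cs (n / 24) * refl cs (n % 24) :=
  cs.wordProd_append _ _

theorem wordProd_carterWord :
    cs.wordProd carterWord = refl cs 0 * refl cs 2 * refl cs 1 * refl cs 3 := by
  simp only [carterWord, cs.wordProd_append, refl, mul_assoc]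

theorem lengthParity_wordProd (x : List (Fin 4)) :
    cs.lengthParity (cs.wordProd x) = Multiplicative.ofAdd (x.length : ZMod 2) := by
  induction x with
  | nil => simp
  | cons i x ih =>
    rw [cs.wordProd_cons, map_mul, ih, cs.lengthParity_simple, ← ofAdd_add, List.length_cons]
    push_cast
    rw [add_comm]

/-- Elements of odd length are products of three reflections. -/
theorem exists_three_reflections {g : W} (hg : cs.lengthParity g = Multiplicative.ofAdd 1) :
    ∃ a < 24, ∃ b < 24, ∃ c < 24, refl cs a * refl cs b * refl cs c = g := by
  obtain ⟨x, hx, rfl⟩ := exists_normalWord cs g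
  have hodd : x.length % 2 = 1 := by
    rw [lengthParity_wordProd] at hg
    have h : ((x.length : ℕ) : ZMod 2) = ((1 : ℕ) : ZMod 2) := by
      simpa using Multiplicative.ofAdd.injective hg
    exact (ZMod.natCast_eq_natCast_iff' _ _ _).1 h
  have h := List.all_eq_true.1 odd_check x hx
  simp only [hodd, Bool.or_eq_true, List.any_eq_true, List.mem_range, Bool.and_eq_true,
    decide_eq_true_eq, beq_iff_eq, one_ne_zero, false_or] at h
  obtain ⟨k, hk, hn, h⟩ := h
  generalize (pairCandidates (wordAct (reflectionWord k) (position x))).log2 = n at hn h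
  rw [← position_append] at h
  have h := (wordProd_eq_iff cs _ _).2 h
  rw [wordProd_pairWord, cs.wordProd_append, ← refl] at h
  refine ⟨k, hk, n / 24, by lia, n % 24, by lia, ?_⟩
  rw [mul_assoc, h, ← mul_assoc, (isReflection_refl cs hk).mul_self, one_mul]

/-- Every element is a product of at most four reflections. -/
theorem exists_four_reflections (g : W) :
    ∃ l : List W, l.length ≤ 4 ∧ (∀ t ∈ l, cs.IsReflection t) ∧ l.prod = g := by
  rcases (show ∀ z : ZMod 2, z = 1 ∨ 1 + z = 1 by decide) (cs.lengthParity g).toAdd with h | h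
  · obtain ⟨a, ha, b, hb, c, hc, h⟩ := exists_three_reflections cs (g := g)
      (Multiplicative.toAdd.injective h)
    refine ⟨[refl cs a, refl cs b, refl cs c], by simp, ?_, by simpa [mul_assoc] using h⟩
    simp [isReflection_refl, ha, hb, hc]
  · obtain ⟨a, ha, b, hb, c, hc, h⟩ := exists_three_reflections cs (g := cs.simple 0 * g) (by
      rw [map_mul, cs.lengthParity_simple]
      exact Multiplicative.toAdd.injective h)
    refine ⟨[cs.simple 0, refl cs a, refl cs b, refl cs c], by simp, ?_, ?_⟩
    · simp [isReflection_refl, ha, hb, hc, cs.isReflection_simple]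
    · simp only [List.prod_cons, List.prod_nil, mul_one, ← mul_assoc (refl cs a), h]
      simp

theorem reflectionLength_le {l : List W} (hl : ∀ t ∈ l, cs.IsReflection t) :
    reflectionLength cs l.prod ≤ l.length :=
  Nat.sInf_le ⟨l, rfl, hl, rfl⟩

theorem exists_isReducedDecomposition (g : W) : ∃ l, IsReducedDecomposition cs g l := by
  obtain ⟨l, -, hl, hg⟩ := exists_four_reflections cs g
  obtain ⟨l', h1, h2, h3⟩ := Nat.sInf_mem (s := {k : ℕ | ∃ l : List W, l.length = k ∧
    (∀ t ∈ l, cs.IsReflection t) ∧ l.prod = g}) ⟨_, l, rfl, hl, hg⟩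
  exact ⟨l', h2, h3, h1⟩

theorem reflectionLength_eq_four {g : W} (hg : IsQuasiCoxeter cs g) :
    reflectionLength cs g = 4 := by
  obtain ⟨l, ⟨hl, -, hlen⟩, hgen⟩ := hg
  obtain ⟨l', h4, hl', rfl⟩ := exists_four_reflections cs g
  exact le_antisymm ((reflectionLength_le cs hl').trans h4)
    (hlen ▸ four_le_length_of_generates cs hl hgen)

theorem det_of_toFun (p q r s : Weight) :
    (Matrix.of ![p.toFun, q.toFun, r.toFun, s.toFun]).det = detWeights p q r s := by
  obtain ⟨p₀, p₁, p₂, p₃⟩ := p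
  obtain ⟨q₀, q₁, q₂, q₃⟩ := q
  obtain ⟨r₀, r₁, r₂, r₃⟩ := r
  obtain ⟨s₀, s₁, s₂, s₃⟩ := s
  simp [Matrix.det_succ_row_zero, Fin.sum_univ_succ, Weight.toFun, detWeights, Fin.succAbove]
  ring

theorem det_eq_fixDet (x : List (Fin 4)) :
    (weightRep cs (cs.wordProd x) - 1).det = fixDet x := by
  rw [fixDet, ← det_of_toFun, ← Matrix.det_transpose]
  congr 1
  have hcol : ∀ (e : Weight) (j : Fin 4), e.toFun = Pi.single j 1 →
      (wordAct x e - e).toFun = (weightRep cs (cs.wordProd x) - 1).col j := by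
    intro e j he
    rw [← Matrix.mulVec_single_one, Matrix.sub_mulVec, Matrix.one_mulVec, ← he,
      weightRep_wordProd]
    ext k
    fin_cases k <;> rfl
  ext i j
  fin_cases i
  · exact (congrFun (hcol (1, 0, 0, 0) 0 (by decide)) j).symm
  · exact (congrFun (hcol (0, 1, 0, 0) 1 (by decide)) j).symm
  · exact (congrFun (hcol (0, 0, 1, 0) 2 (by decide)) j).symm
  · exact (congrFun (hcol (0, 0, 0, 1) 3 (by decide)) j).symm

theorem exists_conj_of_mem_conjugateWords {c y : List (Fin 4)} (hy : y ∈ conjugateWords c) :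
    ∃ g, cs.wordProd y = g * cs.wordProd c * g⁻¹ := by
  simp only [conjugateWords, List.mem_flatMap, List.mem_cons, List.not_mem_nil, or_false] at hy
  have hconj : ∀ u, cs.wordProd (u ++ (c ++ u.reverse)) =
      cs.wordProd u * cs.wordProd c * (cs.wordProd u)⁻¹ := fun u => by
    rw [cs.wordProd_append, cs.wordProd_append, cs.wordProd_reverse, mul_assoc]
  obtain ⟨x₂, -, x₁, -, x₀, -, rfl | rfl⟩ := hy
  exacts [⟨_, hconj _⟩, ⟨_, hconj _⟩]

/-- A quasi-Coxeter element is a Coxeter element or conjugate to `carterWord`. -/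
theorem isCoxeterElement_or_exists_conj {g : W} (hg : IsQuasiCoxeter cs g) :
    IsCoxeterElement cs g ∨ ∃ u, g = u * cs.wordProd carterWord * u⁻¹ := by
  have h4 := reflectionLength_eq_four cs hg
  obtain ⟨l, ⟨hl, hprod, hlen⟩, hgen⟩ := hg
  rw [h4, List.length_eq_four] at hlen
  obtain ⟨t₀, t₁, t₂, t₃, rfl⟩ := hlen
  obtain ⟨x, hx, hxg⟩ := exists_normalWord cs g
  have hg' : g = t₀ * t₁ * t₂ * t₃ := by
    rw [← hprod]
    simp [mul_assoc]
  have hdet : ∀ p : ℕ, p.Prime → ¬ (p : ℤ) ∣ fixDet x := by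
    intro p hp
    have : Fact p.Prime := ⟨hp⟩
    rw [← det_eq_fixDet cs, hxg, hg']
    exact not_dvd_det cs hl hgen p
  have h2 := hdet 2 Nat.prime_two
  have h3 := hdet 3 Nat.prime_three
  have h := List.all_eq_true.1 conjugateWords_check x hx
  simp only [Bool.or_eq_true, beq_iff_eq, List.any_eq_true] at h
  rcases h with ((h | h) | ⟨y, hy, h⟩) | ⟨y, hy, h⟩
  · exact absurd (Int.dvd_of_emod_eq_zero h) h2
  · exact absurd (Int.dvd_of_emod_eq_zero h) h3
  · left
    obtain ⟨u, hu⟩ := exists_conj_of_mem_conjugateWords cs hy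
    rw [(wordProd_eq_iff cs y x).2 h, hxg] at hu
    exact ⟨[0, 1, 2, 3], by decide, by decide, isConj_iff.2 ⟨u, hu.symm⟩⟩
  · right
    obtain ⟨u, hu⟩ := exists_conj_of_mem_conjugateWords cs hy
    rw [(wordProd_eq_iff cs y x).2 h, hxg] at hu
    exact ⟨u, hu⟩

end Classification

/-! ### The reduced decompositions of a proper quasi-Coxeter element -/

/-- For `n = 24 * a + b`, every decomposition of `w` with first factors `a, b` lies in the Hurwitz
orbit: its last two factors multiply to `b a w`. -/
theorem hurwitzOrbit_check : ∀ n < 576,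
    let v := position (reflectionWord (n % 24) ++ (reflectionWord (n / 24) ++ carterWord))
    pairCandidates v &&& digitBlock hurwitzOrbit n = pairCandidates v := by
  decide +kernel

theorem testBit_digitBlock {K n k : ℕ} (hk : k < 576) :
    (digitBlock K n).testBit k = K.testBit (576 * n + k) := by
  rw [digitBlock, Nat.testBit_mod_two_pow, Nat.testBit_shiftRight]
  simp [hk]

theorem testBit_pairCandidates {n : ℕ} (hn : n < 576) {v : Weight}
    (hv : position (pairWord n) = v) : (pairCandidates v).testBit n = true := by
  have key : ∀ p, (digitBlock (pairTable p) (weightCode v % p)).testBit n = true := by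
    intro p
    rw [testBit_digitBlock hn, pairTable, ← hv]
    have : ∀ l : List ℕ, n ∈ l → (l.foldr (fun n => bitInsert (576 * (weightCode
        (position (pairWord n)) % p) + n)) 0).testBit
        (576 * (weightCode (position (pairWord n)) % p) + n) = true := by
      intro l
      induction l with
      | nil => simp
      | cons m l ih =>
        intro hm
        rw [List.foldr_cons, bitInsert, Nat.testBit_or, Bool.or_eq_true]
        rcases List.mem_cons.1 hm with rfl | hm
        · right
          rw [Nat.testBit_two_pow_self]
        · exact .inl (ih hm)
    exact this _ (List.mem_range.2 hn)
  simp only [pairCandidates, Nat.testBit_and, key, Bool.and_self]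

section Frame

variable {W : Type*} [Group W] (cs : CoxeterSystem CoxeterMatrix.F₄ W)

/-- A numbering of the reflections adapted to the element `w`: the reflections `0, 1, 2, 3` realise
`F₄(a₁)` as a Carter diagram of `w`, and the combinatorics of the decompositions of `w` is the one
recorded in `basePairs` and `hurwitzOrbit`. -/
structure IsFrame (w : W) (r : ℕ → W) : Prop where
  isReflection : ∀ k < 24, cs.IsReflection (r k)
  exists_eq : ∀ t, cs.IsReflection t → ∃ k < 24, r k = t
  prod : r 0 * r 2 * r 1 * r 3 = w
  mem_hurwitzOrbit : ∀ a < 24, ∀ b < 24, ∀ c < 24, ∀ d < 24, r a * r b * r c * r d = w →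
    hurwitzOrbit.testBit (quadCode a b c d) = true
  dualBraid : ∀ p ∈ basePairs, DualBraid r p.1 p.2
  exists_completion : ∀ p ∈ basePairs, ∃ c < 24, ∃ d < 24, r p.1 * r p.2 * r c * r d = w
  orderOf : ∀ i j : Fin 4, orderOf (r i * r j) = carterF₄a₁ i j

theorem hurwitzOrbit_complete {a b c d : ℕ} (ha : a < 24) (hb : b < 24) (hc : c < 24) (hd : d < 24)
    (h : refl cs a * refl cs b * refl cs c * refl cs d = cs.wordProd carterWord) :
    hurwitzOrbit.testBit (quadCode a b c d) = true := by
  have hn := hurwitzOrbit_check (24 * a + b) (by lia)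
  have ha' := (isReflection_refl cs ha).mul_self
  have hb' := (isReflection_refl cs hb).mul_self
  have hw : cs.wordProd (pairWord (24 * c + d)) =
      cs.wordProd (reflectionWord b ++ (reflectionWord a ++ carterWord)) := by
    rw [wordProd_pairWord, cs.wordProd_append, cs.wordProd_append, ← h, ← refl, ← refl,
      show (24 * c + d) / 24 = c by lia, show (24 * c + d) % 24 = d by lia]
    simp only [← mul_assoc]
    rw [mul_assoc (refl cs b), ha', mul_one, hb', one_mul]
  simp only [show (24 * a + b) / 24 = a by lia, show (24 * a + b) % 24 = b by lia] at hn
  have hbit := testBit_pairCandidates (n := 24 * c + d) (by lia) ((wordProd_eq_iff cs _ _).1 hw)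
  rw [← hn, Nat.testBit_and, Bool.and_eq_true, testBit_digitBlock (by lia)] at hbit
  rw [quadCode, ← hbit.2]
  congr 1
  ring

theorem wordProd_flatten_replicate (n : ℕ) (x : List (Fin 4)) :
    cs.wordProd (List.replicate n x).flatten = cs.wordProd x ^ n := by
  induction n with
  | zero => simp
  | succ n ih => rw [List.replicate_succ, List.flatten_cons, cs.wordProd_append, ih, pow_succ']

/-- The order of the product of the reflections `i` and `j` of the diagram `F₄(a₁)`. -/
def carterOrder (i j : Fin 4) : ℕ := carterF₄a₁ i j

theorem isFrame_carterWord : IsFrame cs (cs.wordProd carterWord) (refl cs) where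
  isReflection _ := isReflection_refl cs
  exists_eq _ := exists_refl_eq cs
  prod := (wordProd_carterWord cs).symm
  mem_hurwitzOrbit _ ha _ hb _ hc _ hd := hurwitzOrbit_complete cs ha hb hc hd
  dualBraid := by
    have key : ∀ p ∈ basePairs, position (reflectionWord p.1 ++ reflectionWord p.2) =
        position (reflectionWord p.2 ++ reflectionWord (conjIdx p.1 p.2)) := by
      decide +kernel
    intro p hp
    have := (wordProd_eq_iff cs _ _).2 (key p hp)
    rwa [cs.wordProd_append, cs.wordProd_append] at this
  exists_completion := by
    have key : ∀ p ∈ basePairs,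
        let n := (digitBlock hurwitzOrbit (24 * p.1 + p.2)).log2
        n < 576 ∧ position (reflectionWord p.1 ++ (reflectionWord p.2 ++ pairWord n)) =
          position carterWord := by
      decide +kernel
    intro p hp
    obtain ⟨hn, h⟩ := key p hp
    generalize (digitBlock hurwitzOrbit (24 * p.1 + p.2)).log2 = n at hn h
    refine ⟨n / 24, by lia, n % 24, by lia, ?_⟩
    rw [← (wordProd_eq_iff cs _ _).2 h, cs.wordProd_append, cs.wordProd_append, wordProd_pairWord]
    simp only [refl, mul_assoc]
  orderOf := by
    have key : ∀ i j : Fin 4,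
        position (List.replicate (carterOrder i j)
          (reflectionWord i ++ reflectionWord j)).flatten = position [] ∧
        ∀ m < carterOrder i j, 0 < m →
          position (List.replicate m (reflectionWord i ++ reflectionWord j)).flatten ≠
            position [] := by
      decide +kernel
    have hpos : ∀ i j : Fin 4, 0 < carterOrder i j := by decide
    intro i j
    change _ = carterOrder i j
    obtain ⟨h1, h2⟩ := key i j
    have hpow : ∀ m, position (List.replicate m (reflectionWord i ++ reflectionWord j)).flatten =
        position [] ↔ (refl cs i * refl cs j) ^ m = 1 := fun m => by
      rw [← wordProd_eq_iff cs, wordProd_flatten_replicate, cs.wordProd_append, cs.wordProd_nil]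
      rfl
    rw [orderOf_eq_iff (hpos i j)]
    exact ⟨(hpow _).1 h1, fun m hm hm0 h => h2 m hm hm0 ((hpow m).2 h)⟩

variable {cs} in
/-- Frames can be conjugated. -/
theorem IsFrame.conj {w : W} {r : ℕ → W} (h : IsFrame cs w r) (u : W) :
    IsFrame cs (u * w * u⁻¹) (fun k => u * r k * u⁻¹) := by
  have hinj := (MulAut.conj u).injective
  have hmul : ∀ x y, u * x * u⁻¹ * (u * y * u⁻¹) = u * (x * y) * u⁻¹ := fun x y => by group
  have hiff : ∀ x y, u * x * u⁻¹ = u * y * u⁻¹ ↔ x = y := fun x y => by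
    rw [mul_left_inj, mul_right_inj]
  refine ⟨fun k hk => (h.isReflection k hk).conj u, fun t ht => ?_, ?_, ?_, ?_, ?_, fun i j => ?_⟩
  · obtain ⟨k, hk, hkt⟩ := h.exists_eq _ (ht.conj u⁻¹)
    exact ⟨k, hk, by rw [hkt]; group⟩
  · simp only [hmul, hiff]
    exact h.prod
  · simp only [hmul, hiff]
    exact h.mem_hurwitzOrbit
  · simp only [DualBraid, hmul, hiff]
    exact h.dualBraid
  · simp only [hmul, hiff]
    exact h.exists_completion
  · rw [hmul, ← h.orderOf i j]
    exact (MulAut.conj u).orderOf_eq (r i * r j)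

/-- Every proper quasi-Coxeter element has a frame. -/
theorem exists_isFrame {w : W} (hw : IsProperQuasiCoxeter cs w) : ∃ r, IsFrame cs w r := by
  obtain ⟨u, rfl⟩ := (isCoxeterElement_or_exists_conj cs hw.1).resolve_left hw.2
  exact ⟨_, (isFrame_carterWord cs).conj u⟩

end Frame

/-! ### The relations of `F₄(a₁)` and the dual braid relations -/

section Relations

variable {G : Type*} [Group G]

/-- The generators of the dual presentation, expressed in the four generators of the diagram
`F₄(a₁)`. Apart from number 10, each new one is a conjugate `y⁻¹ x y` of two earlier ones. -/
def atomList (s : Fin 4 → G) : List G :=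
  let x₄ := (s 1)⁻¹ * s 0 * s 1
  let x₅ := (s 3)⁻¹ * s 2 * s 3
  let x₆ := (s 3)⁻¹ * s 0 * s 3
  let x₇ := x₆⁻¹ * s 3 * x₆
  let x₈ := (s 1)⁻¹ * s 2 * s 1
  let x₉ := x₈⁻¹ * s 1 * x₈
  let x₁₀ := s 2 * x₄ * (s 2)⁻¹
  let x₁₁ := (s 1)⁻¹ * x₅ * s 1
  let x₁₂ := x₅⁻¹ * s 0 * x₅
  let x₁₃ := x₈⁻¹ * s 0 * x₈
  let x₁₄ := x₁₁⁻¹ * s 1 * x₁₁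
  let x₁₅ := x₁₄⁻¹ * s 0 * x₁₄
  let x₁₆ := x₄⁻¹ * s 2 * x₄
  let x₁₇ := x₆⁻¹ * s 2 * x₆
  let x₁₈ := x₇⁻¹ * s 2 * x₇
  let x₁₉ := x₁₄⁻¹ * s 3 * x₁₄
  let x₂₀ := (s 3)⁻¹ * x₄ * s 3
  let x₂₁ := x₂₀⁻¹ * s 3 * x₂₀
  let x₂₂ := x₂₁⁻¹ * s 1 * x₂₁
  let x₂₃ := x₂₁⁻¹ * s 2 * x₂₁
  [s 0, s 1, s 2, s 3, x₄, x₅, x₆, x₇, x₈, x₉, x₁₀, x₁₁, x₁₂, x₁₃, x₁₄, x₁₅, x₁₆, x₁₇, x₁₈, x₁₉,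
    x₂₀, x₂₁, x₂₂, x₂₃]

/-- The generator number `k` of the dual presentation. -/
def atom (s : Fin 4 → G) (k : ℕ) : G := (atomList s).getD k 1

/-- A family satisfying the dual braid relations is determined by its first four members. -/
theorem eq_atom {γ : ℕ → G} (h : ∀ p ∈ basePairs, DualBraid γ p.1 p.2) {k : ℕ} (hk : k < 24) :
    γ k = atom (fun i => γ i) k := by
  have f : ∀ a t, (a, t) ∈ basePairs → γ (conjIdx a t) = (γ t)⁻¹ * γ a * γ t :=
    fun a t ha => (dualBraid_iff γ a t).1 (h (a, t) ha)
  have e₄ : γ 4 = (γ 1)⁻¹ * γ 0 * γ 1 := f 0 1 (by decide)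
  have e₅ : γ 5 = (γ 3)⁻¹ * γ 2 * γ 3 := f 2 3 (by decide)
  have e₆ : γ 6 = (γ 3)⁻¹ * γ 0 * γ 3 := f 0 3 (by decide)
  have e₇ : γ 7 = (γ 6)⁻¹ * γ 3 * γ 6 := f 3 6 (by decide)
  have e₈ : γ 8 = (γ 1)⁻¹ * γ 2 * γ 1 := f 2 1 (by decide)
  have e₉ : γ 9 = (γ 8)⁻¹ * γ 1 * γ 8 := f 1 8 (by decide)
  have e₁₀ : γ 10 = γ 2 * γ 4 * (γ 2)⁻¹ := by
    have : γ 4 = (γ 2)⁻¹ * γ 10 * γ 2 := f 10 2 (by decide)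
    rw [this]
    group
  have e₁₁ : γ 11 = (γ 1)⁻¹ * γ 5 * γ 1 := f 5 1 (by decide)
  have e₁₂ : γ 12 = (γ 5)⁻¹ * γ 0 * γ 5 := f 0 5 (by decide)
  have e₁₃ : γ 13 = (γ 8)⁻¹ * γ 0 * γ 8 := f 0 8 (by decide)
  have e₁₄ : γ 14 = (γ 11)⁻¹ * γ 1 * γ 11 := f 1 11 (by decide)
  have e₁₅ : γ 15 = (γ 14)⁻¹ * γ 0 * γ 14 := f 0 14 (by decide)
  have e₁₆ : γ 16 = (γ 4)⁻¹ * γ 2 * γ 4 := f 2 4 (by decide)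
  have e₁₇ : γ 17 = (γ 6)⁻¹ * γ 2 * γ 6 := f 2 6 (by decide)
  have e₁₈ : γ 18 = (γ 7)⁻¹ * γ 2 * γ 7 := f 2 7 (by decide)
  have e₁₉ : γ 19 = (γ 14)⁻¹ * γ 3 * γ 14 := f 3 14 (by decide)
  have e₂₀ : γ 20 = (γ 3)⁻¹ * γ 4 * γ 3 := f 4 3 (by decide)
  have e₂₁ : γ 21 = (γ 20)⁻¹ * γ 3 * γ 20 := f 3 20 (by decide)
  have e₂₂ : γ 22 = (γ 21)⁻¹ * γ 1 * γ 21 := f 1 21 (by decide)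
  have e₂₃ : γ 23 = (γ 21)⁻¹ * γ 2 * γ 21 := f 2 21 (by decide)
  interval_cases k <;>
    (try simp only [e₂₃, e₂₂, e₂₁, e₂₀, e₁₉, e₁₈, e₁₇, e₁₆, e₁₅, e₁₄, e₁₃, e₁₂, e₁₁, e₁₀, e₉, e₈,
      e₇, e₆, e₅, e₄]) <;> rfl

theorem map_atom {H : Type*} [Group H] (f : G →* H) (s : Fin 4 → G) (k : ℕ) :
    f (atom s k) = atom (fun i => f (s i)) k := by
  have : (atomList s).map f = atomList fun i => f (s i) := by
    simp [atomList]
  rw [atom, atom, ← this, ← map_one f, List.getD_map]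

/-- The defining relations of `F₄(a₁)` for a quadruple of group elements. -/
structure CarterRelations (s : Fin 4 → G) : Prop where
  braid₀₁ : s 0 * s 1 * s 0 = s 1 * s 0 * s 1
  braid₂₃ : s 2 * s 3 * s 2 = s 3 * s 2 * s 3
  braid₀₃ : s 0 * s 3 * s 0 * s 3 = s 3 * s 0 * s 3 * s 0
  braid₁₂ : s 1 * s 2 * s 1 * s 2 = s 2 * s 1 * s 2 * s 1
  comm₀₂ : s 0 * s 2 = s 2 * s 0
  comm₁₃ : s 1 * s 3 = s 3 * s 1
  twisted : Commute ((s 1)⁻¹ * s 0 * s 1) ((s 2)⁻¹ * s 3 * s 2)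
  twisted' : Commute (s 1 * s 0 * (s 1)⁻¹) (s 2 * s 3 * (s 2)⁻¹)

section BraidRel

variable {B : Type*} (M : CoxeterMatrix B) (s : B → G) {i j : B}

theorem lift_braidRel_eq_one_iff : FreeGroup.lift s (braidRel M i j) = 1 ↔
    ((CoxeterSystem.braidWord M i j).map s).prod =
      ((CoxeterSystem.braidWord M j i).map s).prod := by
  have hl : ∀ l : List B, FreeGroup.lift s (l.map FreeGroup.of).prod = (l.map s).prod := by
    intro l
    rw [map_list_prod, List.map_map]
    congr 1
    exact List.map_congr_left fun k _ => FreeGroup.lift_apply_of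
  rw [braidRel, map_mul, map_inv, mul_inv_eq_one, hl, hl]

theorem lift_braidRel_self : FreeGroup.lift s (braidRel M i i) = 1 :=
  (lift_braidRel_eq_one_iff M s).2 rfl

theorem lift_braidRel_two (h : M i j = 2) :
    FreeGroup.lift s (braidRel M i j) = 1 ↔ s i * s j = s j * s i := by
  rw [lift_braidRel_eq_one_iff]
  simp [CoxeterSystem.braidWord, M.symmetric j i, h, CoxeterSystem.alternatingWord]

theorem lift_braidRel_three (h : M i j = 3) :
    FreeGroup.lift s (braidRel M i j) = 1 ↔ s i * s j * s i = s j * s i * s j := by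
  rw [lift_braidRel_eq_one_iff, eq_comm]
  simp [CoxeterSystem.braidWord, M.symmetric j i, h, CoxeterSystem.alternatingWord, mul_assoc]

theorem lift_braidRel_four (h : M i j = 4) :
    FreeGroup.lift s (braidRel M i j) = 1 ↔ s i * s j * s i * s j = s j * s i * s j * s i := by
  rw [lift_braidRel_eq_one_iff]
  simp [CoxeterSystem.braidWord, M.symmetric j i, h, CoxeterSystem.alternatingWord, mul_assoc]

end BraidRel

theorem lift_relsF₄a₁_iff (s : Fin 4 → G) :
    (∀ x ∈ relsF₄a₁, FreeGroup.lift s x = 1) ↔ CarterRelations s := by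
  constructor
  · intro h
    have hb (i j) := h (braidRel carterF₄a₁ i j) (.inl ⟨i, j, rfl⟩)
    have h₁ := h _ (.inr (.inl rfl))
    have h₂ := h _ (.inr (.inr rfl))
    simp only [map_commutatorElement, map_mul, map_inv, FreeGroup.lift_apply_of,
      commutatorElement_eq_one_iff_commute] at h₁ h₂
    exact ⟨(lift_braidRel_three _ s rfl).1 (hb 0 1), (lift_braidRel_three _ s rfl).1 (hb 2 3),
      (lift_braidRel_four _ s rfl).1 (hb 0 3), (lift_braidRel_four _ s rfl).1 (hb 1 2),
      (lift_braidRel_two _ s rfl).1 (hb 0 2), (lift_braidRel_two _ s rfl).1 (hb 1 3), h₁, h₂⟩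
  · rintro h x (⟨i, j, rfl⟩ | rfl | rfl)
    · fin_cases i <;> fin_cases j
      · exact lift_braidRel_self _ _
      · exact (lift_braidRel_three _ s rfl).2 h.braid₀₁
      · exact (lift_braidRel_two _ s rfl).2 h.comm₀₂
      · exact (lift_braidRel_four _ s rfl).2 h.braid₀₃
      · exact (lift_braidRel_three _ s rfl).2 h.braid₀₁.symm
      · exact lift_braidRel_self _ _
      · exact (lift_braidRel_four _ s rfl).2 h.braid₁₂
      · exact (lift_braidRel_two _ s rfl).2 h.comm₁₃
      · exact (lift_braidRel_two _ s rfl).2 h.comm₀₂.symm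
      · exact (lift_braidRel_four _ s rfl).2 h.braid₁₂.symm
      · exact lift_braidRel_self _ _
      · exact (lift_braidRel_three _ s rfl).2 h.braid₂₃
      · exact (lift_braidRel_four _ s rfl).2 h.braid₀₃.symm
      · exact (lift_braidRel_two _ s rfl).2 h.comm₁₃.symm
      · exact (lift_braidRel_three _ s rfl).2 h.braid₂₃.symm
      · exact lift_braidRel_self _ _
    · simpa only [map_commutatorElement, map_mul, map_inv, FreeGroup.lift_apply_of,
        commutatorElement_eq_one_iff_commute] using h.twisted
    · simpa only [map_commutatorElement, map_mul, map_inv, FreeGroup.lift_apply_of,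
        commutatorElement_eq_one_iff_commute] using h.twisted'

/-- With `z = y⁻¹ x y`, the braid relation of length 3 is a dual braid relation. -/
theorem dual_iff_braid_three {x y z : G} (hz : x * y = y * z) :
    z * x = x * y ↔ x * y * x = y * x * y := by
  rw [hz, mul_assoc, mul_assoc, mul_right_inj, hz]

/-- With `z = y⁻¹ x y` and `u = z⁻¹ y z`, the braid relation of length 4 is a dual braid
relation. -/
theorem dual_iff_braid_four {x y z u : G} (hz : x * y = y * z) (hu : y * z = z * u) :
    u * x = x * y ↔ x * y * x * y = y * x * y * x := by
  have : y * x * y * x = x * y * (u * x) := by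
    rw [mul_assoc y x y, hz, hu, ← mul_assoc, hu]
    simp only [mul_assoc]
  rw [this, mul_assoc (x * y), mul_right_inj, eq_comm]

/-- A family satisfying the dual braid relations satisfies the relations of `F₄(a₁)`. -/
theorem carterRelations_of_dualBraid {γ : ℕ → G} (h : ∀ p ∈ basePairs, DualBraid γ p.1 p.2) :
    CarterRelations (fun i => γ i) := by
  have f : ∀ a t, (a, t) ∈ basePairs → γ a * γ t = γ t * γ (conjIdx a t) :=
    fun a t ha => h (a, t) ha
  have h₀₁ : γ 0 * γ 1 = γ 1 * γ 4 := f 0 1 (by decide)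
  have h₂₃ : γ 2 * γ 3 = γ 3 * γ 5 := f 2 3 (by decide)
  have h₅₂ : γ 5 * γ 2 = γ 2 * γ 3 := f 5 2 (by decide)
  have h₁₀ : γ 10 * γ 2 = γ 2 * γ 4 := f 10 2 (by decide)
  have h₅₁ : γ 5 * γ 1 = γ 1 * γ 11 := f 5 1 (by decide)
  have c₁₀ : Commute (γ 10) (γ 3) := f 10 3 (by decide)
  have c₁₁ : Commute (γ 0) (γ 11) := (f 11 0 (by decide)).symm
  refine ⟨(dual_iff_braid_three h₀₁).1 (f 4 0 (by decide)), (dual_iff_braid_three h₂₃).1 h₅₂,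
    (dual_iff_braid_four (f 0 3 (by decide)) (f 3 6 (by decide))).1 (f 7 0 (by decide)),
    ((dual_iff_braid_four (f 2 1 (by decide)) (f 1 8 (by decide))).1 (f 9 2 (by decide))).symm,
    f 0 2 (by decide), f 1 3 (by decide), ?_, ?_⟩
  · have e : (γ 1)⁻¹ * γ 0 * γ 1 = (γ 2)⁻¹ * γ 10 * γ 2 := by
      rw [mul_assoc, h₀₁, mul_assoc, h₁₀, inv_mul_cancel_left, inv_mul_cancel_left]
    change Commute ((γ 1)⁻¹ * γ 0 * γ 1) ((γ 2)⁻¹ * γ 3 * γ 2)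
    rw [e]
    simpa using (Commute.conj_iff (γ 2)⁻¹).2 c₁₀
  · have e : γ 2 * γ 3 * (γ 2)⁻¹ = γ 1 * γ 11 * (γ 1)⁻¹ := by
      rw [← h₅₂, ← h₅₁, mul_inv_cancel_right, mul_inv_cancel_right]
    change Commute (γ 1 * γ 0 * (γ 1)⁻¹) (γ 2 * γ 3 * (γ 2)⁻¹)
    rw [e]
    exact (Commute.conj_iff (γ 1)).2 c₁₁

/-- The relations of `F₄(a₁)` imply the dual braid relations. -/
theorem CarterRelations.dualBraid {s : Fin 4 → G} (h : CarterRelations s) :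
    ∀ p ∈ basePairs, DualBraid (atom s) p.1 p.2 := by
  have conj (x y : G) : x * y = y * (y⁻¹ * x * y) := by group
  have f₀₁ : atom s 0 * atom s 1 = atom s 1 * atom s 4 := conj _ _
  have f₂₃ : atom s 2 * atom s 3 = atom s 3 * atom s 5 := conj _ _
  have f₀₃ : atom s 0 * atom s 3 = atom s 3 * atom s 6 := conj _ _
  have f₃₆ : atom s 3 * atom s 6 = atom s 6 * atom s 7 := conj _ _
  have f₂₁ : atom s 2 * atom s 1 = atom s 1 * atom s 8 := conj _ _
  have f₁₈ : atom s 1 * atom s 8 = atom s 8 * atom s 9 := conj _ _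
  have f₄₀ : atom s 4 * atom s 0 = atom s 0 * atom s 1 := (dual_iff_braid_three f₀₁).2 h.braid₀₁
  have f₅₂ : atom s 5 * atom s 2 = atom s 2 * atom s 3 := (dual_iff_braid_three f₂₃).2 h.braid₂₃
  have f₇₀ : atom s 7 * atom s 0 = atom s 0 * atom s 3 :=
    (dual_iff_braid_four f₀₃ f₃₆).2 h.braid₀₃
  have f₉₂ : atom s 9 * atom s 2 = atom s 2 * atom s 1 :=
    (dual_iff_braid_four f₂₁ f₁₈).2 h.braid₁₂.symm
  have f₁₀ : atom s 10 * atom s 2 = atom s 2 * atom s 4 := inv_mul_cancel_right _ _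
  have f₅₁ : atom s 5 * atom s 1 = atom s 1 * atom s 11 := conj _ _
  have c₁₀ : Commute (atom s 10) (atom s 3) := by
    have e : s 3 = s 2 * ((s 2)⁻¹ * s 3 * s 2) * (s 2)⁻¹ := by group
    change Commute _ (s 3)
    rw [e]
    exact (Commute.conj_iff (s 2)).2 h.twisted
  have c₁₁ : Commute (atom s 11) (atom s 0) := by
    have e : atom s 2 * atom s 3 * (atom s 2)⁻¹ = atom s 1 * atom s 11 * (atom s 1)⁻¹ := by
      rw [← f₅₂, ← f₅₁, mul_inv_cancel_right, mul_inv_cancel_right]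
    have h' : Commute (atom s 1 * atom s 0 * (atom s 1)⁻¹)
      (atom s 2 * atom s 3 * (atom s 2)⁻¹) := h.twisted'
    rw [e] at h'
    exact ((Commute.conj_iff (atom s 1)).1 h').symm
  simp only [basePairs, List.forall_mem_cons]
  exact ⟨f₀₁, f₀₁.symm.trans f₄₀.symm, f₂₃, f₂₃.symm.trans f₅₂.symm, f₀₃, f₃₆,
    f₃₆.symm.trans (f₀₃.symm.trans f₇₀.symm), f₂₁, f₁₈, f₁₈.symm.trans (f₂₁.symm.trans f₉₂.symm),
    h.comm₀₂, h.comm₁₃, f₁₀, f₅₁, c₁₀, c₁₁, conj _ _, conj _ _, conj _ _, conj _ _, conj _ _,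
    conj _ _, conj _ _, conj _ _, conj _ _, conj _ _, conj _ _, conj _ _, f₄₀, f₅₂, f₇₀, f₉₂,
    h.comm₀₂.symm, h.comm₁₃.symm, List.forall_mem_nil _⟩

end Relations

/-! ### The interval group -/

section Interval

variable {W : Type*} [Group W] {cs : CoxeterSystem CoxeterMatrix.F₄ W} {w : W} {r : ℕ → W}

theorem reflectionLength_mul_le (x y : W) :
    reflectionLength cs (x * y) ≤ reflectionLength cs x + reflectionLength cs y := by
  obtain ⟨l, hl, rfl, hx⟩ := exists_isReducedDecomposition cs x
  obtain ⟨m, hm, rfl, hy⟩ := exists_isReducedDecomposition cs y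
  rw [← hx, ← hy, ← List.prod_append, ← List.length_append]
  exact reflectionLength_le cs fun t ht => (List.mem_append.1 ht).elim (hl t) (hm t)

/-- The list of numbers `l` encodes a reduced decomposition of the element `w` of reflection
length 4. -/
structure IsFactorization (r : ℕ → W) (w : W) (l : List ℕ) : Prop where
  length : l.length = 4
  lt : ∀ k ∈ l, k < 24
  prod : (l.map r).prod = w

theorem IsFrame.reflectionLength_prod_le (h : IsFrame cs w r) {l : List ℕ} (hl : ∀ k ∈ l, k < 24) :
    reflectionLength cs (l.map r).prod ≤ l.length := by
  rw [← List.length_map (f := r)]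
  refine reflectionLength_le cs fun t ht => ?_
  obtain ⟨k, hk, rfl⟩ := List.mem_map.1 ht
  exact h.isReflection k (hl k hk)

theorem IsFrame.exists_map_eq (h : IsFrame cs w r) (l : List W) (hl : ∀ t ∈ l, cs.IsReflection t) :
    ∃ ks : List ℕ, (∀ k ∈ ks, k < 24) ∧ ks.map r = l := by
  induction l with
  | nil => exact ⟨[], by simp⟩
  | cons t l ih =>
    obtain ⟨ks, hks, rfl⟩ := ih fun u hu => hl u (List.mem_cons_of_mem _ hu)
    obtain ⟨k, hk, rfl⟩ := h.exists_eq t (hl t List.mem_cons_self)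
    exact ⟨k :: ks, List.forall_mem_cons.2 ⟨hk, hks⟩, rfl⟩

/-- Prefixes of reduced decompositions of `w` represent elements of the interval. -/
theorem IsFactorization.prefix (h : IsFrame cs w r) (hlen : reflectionLength cs w = 4)
    {ks ms : List ℕ} (hf : IsFactorization r w (ks ++ ms)) :
    (ks.map r).prod ∈ interval cs w ∧ reflectionLength cs (ks.map r).prod = ks.length := by
  have hp := hf.prod
  rw [List.map_append, List.prod_append] at hp
  have h₁ := h.reflectionLength_prod_le fun k hk => hf.lt k (List.mem_append_left _ hk)
  have h₂ := h.reflectionLength_prod_le fun k hk => hf.lt k (List.mem_append_right _ hk)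
  have h₃ := reflectionLength_mul_le (cs := cs) (ks.map r).prod (ms.map r).prod
  have h₄ := hf.length
  rw [List.length_append] at h₄
  rw [hp] at h₃
  exact ⟨⟨_, hp.symm, by lia⟩, by lia⟩

theorem IsFrame.exists_factorization (h : IsFrame cs w r) (hlen : reflectionLength cs w = 4)
    {x : W} (hx : x ∈ interval cs w) :
    ∃ ks ms : List ℕ, IsFactorization r w (ks ++ ms) ∧ (ks.map r).prod = x := by
  obtain ⟨y, rfl, hl⟩ := hx
  obtain ⟨l, hl', rfl, hx⟩ := exists_isReducedDecomposition cs x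
  obtain ⟨m, hm', rfl, hy⟩ := exists_isReducedDecomposition cs y
  obtain ⟨ks, hks, rfl⟩ := h.exists_map_eq l hl'
  obtain ⟨ms, hms, rfl⟩ := h.exists_map_eq m hm'
  rw [List.length_map] at hx hy
  refine ⟨ks, ms, ⟨?_, fun k hk => (List.mem_append.1 hk).elim (hks k) (hms k), ?_⟩, rfl⟩
  · rw [List.length_append]
    lia
  · rw [List.map_append, List.prod_append]

/-- The first factor of a decomposition can be moved to the end at the cost of conjugating it. -/
theorem IsFactorization.rotate (h : IsFrame cs w r) {k : ℕ} {ls : List ℕ}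
    (hf : IsFactorization r w (k :: ls)) : ∃ k', IsFactorization r w (ls ++ [k']) := by
  obtain ⟨k', hk', he⟩ := h.exists_eq _
    ((h.isReflection k (hf.lt k List.mem_cons_self)).conj (ls.map r).prod⁻¹)
  refine ⟨k', by simpa using hf.length, fun m hm => ?_, ?_⟩
  · rcases List.mem_append.1 hm with hm | hm
    · exact hf.lt m (List.mem_cons_of_mem _ hm)
    · rwa [List.mem_singleton.1 hm]
  · rw [← hf.prod]
    simp [he, mul_assoc]

theorem IsFactorization.exists_cons (h : IsFrame cs w r) {l : List ℕ}
    (hf : IsFactorization r w l) {k : ℕ} (hk : k ∈ l) : ∃ ms, IsFactorization r w (k :: ms) := by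
  obtain ⟨l₁, l₂, rfl⟩ := List.append_of_mem hk
  induction l₁ generalizing l₂ with
  | nil => exact ⟨l₂, hf⟩
  | cons a l₁ ih =>
    rw [List.cons_append] at hf
    obtain ⟨k', hk'⟩ := hf.rotate h
    rw [List.append_assoc] at hk'
    exact ih _ hk' (by simp)

theorem intervalGroup_of_mul {u v x : interval cs w} (hx : (u : W) * v = x)
    (hl : reflectionLength cs (x : W) = reflectionLength cs (u : W) + reflectionLength cs (v : W)) :
    (PresentedGroup.of u * PresentedGroup.of v : IntervalGroup cs w) = PresentedGroup.of x := by
  have : PresentedGroup.mk (intervalRels cs w)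
      (FreeGroup.of u * FreeGroup.of v * (FreeGroup.of x)⁻¹) = 1 :=
    PresentedGroup.one_of_mem ⟨u, v, x, hx, hl, rfl⟩
  rw [map_mul, map_mul, map_inv, mul_inv_eq_one] at this
  exact this

open Classical in
/-- The generator of the interval group belonging to the reflection number `k`; it is `1` if this
reflection does not lie in the interval. -/
noncomputable def intervalGen (cs : CoxeterSystem CoxeterMatrix.F₄ W) (w : W) (r : ℕ → W) (k : ℕ) :
    IntervalGroup cs w :=
  if h : r k ∈ interval cs w then PresentedGroup.of ⟨r k, h⟩ else 1

theorem intervalGen_eq {k : ℕ} (h : r k ∈ interval cs w) :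
    intervalGen cs w r k = PresentedGroup.of ⟨r k, h⟩ := dif_pos h

/-- The lift of `x ≼ w` to the interval group is the product of the lifts of the factors of a
reduced decomposition of `x`. -/
theorem IsFactorization.of_eq (h : IsFrame cs w r) (hlen : reflectionLength cs w = 4)
    {ks ms : List ℕ} (hf : IsFactorization r w (ks ++ ms)) {x : W} (hx : x ∈ interval cs w)
    (he : (ks.map r).prod = x) :
    (PresentedGroup.of ⟨x, hx⟩ : IntervalGroup cs w) = (ks.map (intervalGen cs w r)).prod := by
  subst he
  induction ks generalizing ms with
  | nil =>
    have hl := (hf.prefix h hlen).2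
    have := intervalGroup_of_mul (u := ⟨_, hx⟩) (v := ⟨_, hx⟩) (x := ⟨_, hx⟩) (by simp)
      (by rw [hl]; rfl)
    exact mul_eq_left.1 this
  | cons k ks ih =>
    have hl := (hf.prefix h hlen).2
    have hk := IsFactorization.prefix (ks := [k]) h hlen hf
    rw [List.cons_append] at hf
    obtain ⟨k', hf'⟩ := hf.rotate h
    rw [List.append_assoc] at hf'
    have hks := hf'.prefix h hlen
    rw [List.map_singleton, List.prod_singleton] at hk
    rw [List.map_cons (f := intervalGen cs w r), List.prod_cons, ← ih hf' hks.1,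
      intervalGen_eq hk.1]
    refine (intervalGroup_of_mul (by simp) ?_).symm
    rw [hl, hk.2, hks.2, List.length_cons, List.length_singleton, add_comm]

theorem IsFrame.dualBraid_intervalGen (h : IsFrame cs w r) (hlen : reflectionLength cs w = 4) :
    ∀ p ∈ basePairs, DualBraid (intervalGen cs w r) p.1 p.2 := by
  intro p hp
  have hlt : ∀ p ∈ basePairs, p.1 < 24 ∧ p.2 < 24 := by decide
  obtain ⟨c, hc, d, hd, he⟩ := h.exists_completion p hp
  have hr := h.dualBraid p hp
  rw [DualBraid] at hr ⊢
  have h₁ : IsFactorization r w ([p.1, p.2] ++ [c, d]) :=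
    ⟨rfl, by simp [hlt p hp, hc, hd], by simpa [mul_assoc] using he⟩
  have h₂ : IsFactorization r w ([p.2, conjIdx p.1 p.2] ++ [c, d]) :=
    ⟨rfl, by simp [hlt p hp, hc, hd, conjIdx_lt], by rw [hr] at he; simpa [mul_assoc] using he⟩
  have hx := (h₁.prefix h hlen).1
  have e₁ := h₁.of_eq h hlen hx rfl
  have e₂ := h₂.of_eq h hlen hx (by simpa using hr.symm)
  simpa using e₁.symm.trans e₂

/-- The lift of the reflection number `k` to the group presented by `F₄(a₁)`. -/
def diagramGen (k : ℕ) : PresentedGroup relsF₄a₁ := atom PresentedGroup.of k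

theorem dualBraid_diagramGen : ∀ p ∈ basePairs, DualBraid diagramGen p.1 p.2 := by
  refine CarterRelations.dualBraid ((lift_relsF₄a₁_iff _).1 fun x hx => ?_)
  have : FreeGroup.lift (PresentedGroup.of (rels := relsF₄a₁)) = PresentedGroup.mk relsF₄a₁ := by
    ext i
    rw [FreeGroup.lift_apply_of]
    rfl
  rw [this]
  exact PresentedGroup.one_of_mem hx

theorem IsFactorization.prod_diagramGen (h : IsFrame cs w r) {l : List ℕ}
    (hf : IsFactorization r w l) : (l.map diagramGen).prod =
      diagramGen 0 * diagramGen 2 * diagramGen 1 * diagramGen 3 := by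
  obtain ⟨hl, hlt, hp⟩ := hf
  obtain ⟨a, b, c, d, rfl⟩ : ∃ a b c d, l = [a, b, c, d] := by
    match l, hl with
    | [a, b, c, d], _ => exact ⟨a, b, c, d, rfl⟩
  simp only [List.forall_mem_cons] at hlt
  obtain ⟨ha, hb, hc, hd, -⟩ := hlt
  rw [← mul_eq_of_mem_hurwitzOrbit dualBraid_diagramGen hb hc hd
    (h.mem_hurwitzOrbit a ha b hb c hc d hd (by simpa [mul_assoc] using hp))]
  simp [mul_assoc]

/-- The product of the lifts of the factors of `x ≼ w` depends on `x` only. -/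
theorem IsFactorization.prod_diagramGen_eq (h : IsFrame cs w r)
    {ks ls ms : List ℕ} (hf : IsFactorization r w (ks ++ ms)) (hl : ∀ k ∈ ls, k < 24)
    (hlen : ls.length = ks.length) (he : (ls.map r).prod = (ks.map r).prod) :
    (ls.map diagramGen).prod = (ks.map diagramGen).prod := by
  have hf' : IsFactorization r w (ls ++ ms) := by
    refine ⟨?_, fun k hk => ?_, ?_⟩
    · rw [List.length_append, hlen, ← List.length_append, hf.length]
    · exact (List.mem_append.1 hk).elim (hl k) fun hk => hf.lt k (List.mem_append_right _ hk)
    · rw [← hf.prod, List.map_append, List.map_append, List.prod_append, List.prod_append, he]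
  have := (hf'.prod_diagramGen h).trans (hf.prod_diagramGen h).symm
  simpa using this

/-- The interval group is presented by the relations of `F₄(a₁)`. -/
theorem IsFrame.exists_mulEquiv (h : IsFrame cs w r) (hlen : reflectionLength cs w = 4) :
    ∃ φ : PresentedGroup relsF₄a₁ ≃* IntervalGroup cs w,
      ∀ i : Fin 4, ∃ hi : r i ∈ interval cs w,
        φ (PresentedGroup.of i) = PresentedGroup.of ⟨r i, hi⟩ := by
  have hγ := h.dualBraid_intervalGen hlen
  let φ : PresentedGroup relsF₄a₁ →* IntervalGroup cs w :=
    PresentedGroup.toGroup (f := fun i : Fin 4 => intervalGen cs w r i)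
      ((lift_relsF₄a₁_iff _).2 (carterRelations_of_dualBraid hγ))
  have hφ (i : Fin 4) : φ (PresentedGroup.of i) = intervalGen cs w r i :=
    PresentedGroup.toGroup.of _
  have hφ' {k : ℕ} (hk : k < 24) : φ (diagramGen k) = intervalGen cs w r k := by
    rw [diagramGen, map_atom, eq_atom hγ hk]
    simp only [hφ]
  -- The inverse sends `x` to the lifted product of a chosen reduced decomposition of `x`.
  choose ks ms hf hks using fun x : interval cs w => h.exists_factorization hlen x.2
  have hlt (x : interval cs w) : ∀ k ∈ ks x, k < 24 :=
    fun k hk => (hf x).lt k (List.mem_append_left _ hk)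
  have hlength (x : interval cs w) : reflectionLength cs (x : W) = (ks x).length := by
    rw [← ((hf x).prefix h hlen).2, hks]
  let g (x : interval cs w) : PresentedGroup relsF₄a₁ := ((ks x).map diagramGen).prod
  have hg : ∀ y ∈ intervalRels cs w, FreeGroup.lift g y = 1 := by
    rintro _ ⟨u, v, x, hx, hl, rfl⟩
    rw [map_mul, map_mul, map_inv, mul_inv_eq_one]
    simp only [FreeGroup.lift_apply_of, g]
    rw [← List.prod_append, ← List.map_append]
    refine (hf x).prod_diagramGen_eq h
      (fun k hk => (List.mem_append.1 hk).elim (hlt u k) (hlt v k)) ?_ ?_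
    · rw [List.length_append, ← hlength, ← hlength, ← hlength, hl]
    · rw [List.map_append, List.prod_append, hks, hks, hks, hx]
  let ψ : IntervalGroup cs w →* PresentedGroup relsF₄a₁ := PresentedGroup.toGroup hg
  have hψ (x : interval cs w) : ψ (PresentedGroup.of x) = g x := PresentedGroup.toGroup.of hg
  have hmem (i : Fin 4) : ∃ ls, IsFactorization r w ((i : ℕ) :: ls) := by
    refine IsFactorization.exists_cons h (l := [0, 2, 1, 3])
      ⟨rfl, by decide, by simpa [mul_assoc] using h.prod⟩ ?_
    fin_cases i <;> simp
  have hi (i : Fin 4) : r i ∈ interval cs w := by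
    obtain ⟨ls, hls⟩ := hmem i
    simpa using (IsFactorization.prefix (ks := [(i : ℕ)]) h hlen hls).1
  refine ⟨φ.toMulEquiv ψ (PresentedGroup.ext fun i => ?_) (PresentedGroup.ext fun x => ?_),
    fun i => ⟨hi i, (hφ i).trans (intervalGen_eq (hi i))⟩⟩
  · rw [MonoidHom.comp_apply, hφ, intervalGen_eq (hi i), hψ, MonoidHom.id_apply]
    obtain ⟨ls, hls⟩ := hmem i
    have hone : reflectionLength cs (r i) = 1 := by
      simpa using (IsFactorization.prefix (ks := [(i : ℕ)]) h hlen hls).2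
    have := (hf ⟨r i, hi i⟩).prod_diagramGen_eq h (ls := [(i : ℕ)])
      (fun k hk => hls.lt k (by simp_all)) (by rw [← hlength, hone]; rfl) (by simp [hks])
    refine this.symm.trans ?_
    rw [List.map_singleton, List.prod_singleton, diagramGen]
    fin_cases i <;> rfl
  · rw [MonoidHom.comp_apply, hψ, MonoidHom.id_apply, (hf x).of_eq h hlen x.2 (hks x),
      map_list_prod, List.map_map]
    congr 1
    exact List.map_congr_left fun k hk => hφ' (hlt x k hk)

theorem IsFrame.isCarterDiagram (h : IsFrame cs w r) (hlen : reflectionLength cs w = 4) :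
    IsCarterDiagram cs carterF₄a₁ (fun i => r i) w := by
  have hc : ∀ a t, (a, t) ∈ basePairs → conjIdx a t = a → Commute (r a) (r t) := by
    intro a t hp hat
    have := h.dualBraid _ hp
    rwa [DualBraid, hat] at this
  refine ⟨⟨[0, 2], [1, 3], by decide, by decide, ?_, ?_, ?_, ?_, ?_⟩, h.orderOf⟩
  · have : Commute (r 0) (r 2) := hc 0 2 (by decide) (by decide)
    simp [this, this.symm]
  · have : Commute (r 1) (r 3) := hc 1 3 (by decide) (by decide)
    simp [this, this.symm]
  · have : ∀ i : Fin 4, cs.IsReflection (r i) := fun i => h.isReflection i (by lia)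
    simp [Fin.forall_fin_succ] at this
    simp [this]
  · simpa [mul_assoc] using h.prod
  · rw [hlen]
    rfl

end Interval

/-! ### Homomorphisms to the alternating group of degree 4 -/

section Count

variable {G : Type*} [Group G]

/-- The relations of the Artin group of type `F₄` for a quadruple of group elements. -/
structure ArtinRelations (s : Fin 4 → G) : Prop where
  braid₀₁ : s 0 * s 1 * s 0 = s 1 * s 0 * s 1
  braid₂₃ : s 2 * s 3 * s 2 = s 3 * s 2 * s 3
  braid₁₂ : s 1 * s 2 * s 1 * s 2 = s 2 * s 1 * s 2 * s 1
  comm₀₂ : s 0 * s 2 = s 2 * s 0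
  comm₁₃ : s 1 * s 3 = s 3 * s 1
  comm₀₃ : s 0 * s 3 = s 3 * s 0

theorem lift_braidRels_F₄_iff (s : Fin 4 → G) :
    (∀ x ∈ braidRels CoxeterMatrix.F₄, FreeGroup.lift s x = 1) ↔ ArtinRelations s := by
  constructor
  · intro h
    have hb (i j) := h (braidRel CoxeterMatrix.F₄ i j) ⟨i, j, rfl⟩
    exact ⟨(lift_braidRel_three _ s rfl).1 (hb 0 1), (lift_braidRel_three _ s rfl).1 (hb 2 3),
      (lift_braidRel_four _ s rfl).1 (hb 1 2), (lift_braidRel_two _ s rfl).1 (hb 0 2),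
      (lift_braidRel_two _ s rfl).1 (hb 1 3), (lift_braidRel_two _ s rfl).1 (hb 0 3)⟩
  · rintro h x ⟨i, j, rfl⟩
    fin_cases i <;> fin_cases j
    · exact lift_braidRel_self _ _
    · exact (lift_braidRel_three _ s rfl).2 h.braid₀₁
    · exact (lift_braidRel_two _ s rfl).2 h.comm₀₂
    · exact (lift_braidRel_two _ s rfl).2 h.comm₀₃
    · exact (lift_braidRel_three _ s rfl).2 h.braid₀₁.symm
    · exact lift_braidRel_self _ _
    · exact (lift_braidRel_four _ s rfl).2 h.braid₁₂
    · exact (lift_braidRel_two _ s rfl).2 h.comm₁₃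
    · exact (lift_braidRel_two _ s rfl).2 h.comm₀₂.symm
    · exact (lift_braidRel_four _ s rfl).2 h.braid₁₂.symm
    · exact lift_braidRel_self _ _
    · exact (lift_braidRel_three _ s rfl).2 h.braid₂₃
    · exact (lift_braidRel_two _ s rfl).2 h.comm₀₃.symm
    · exact (lift_braidRel_two _ s rfl).2 h.comm₁₃.symm
    · exact (lift_braidRel_three _ s rfl).2 h.braid₂₃.symm
    · exact lift_braidRel_self _ _

/-- Homomorphisms from a presented group are the families satisfying the relations. -/
def homEquiv {α : Type*} (rels : Set (FreeGroup α)) :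
    (PresentedGroup rels →* G) ≃ {s : α → G // ∀ x ∈ rels, FreeGroup.lift s x = 1} where
  toFun f := ⟨fun i => f (PresentedGroup.of i), fun x hx => by
    have : FreeGroup.lift (fun i => f (PresentedGroup.of i)) =
        f.comp (PresentedGroup.mk rels) := by
      ext i
      rw [FreeGroup.lift_apply_of]
      rfl
    rw [this, MonoidHom.comp_apply, PresentedGroup.one_of_mem hx, map_one]⟩
  invFun s := PresentedGroup.toGroup s.2
  left_inv f := PresentedGroup.ext fun i => PresentedGroup.toGroup.of _
  right_inv s := Subtype.ext <| funext fun i => PresentedGroup.toGroup.of s.2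

/-- The pairs satisfying the braid relation of length 3. -/
def braidPairs (G : Type*) [Group G] [Fintype G] [DecidableEq G] : Finset (G × G) :=
  Finset.univ.filter fun p => p.1 * p.2 * p.1 = p.2 * p.1 * p.2

/-- The solutions `((s 0, s 1), (s 2, s 3))` of the relations of `F₄(a₁)`. -/
def carterSolutions (G : Type*) [Group G] [Fintype G] [DecidableEq G] :
    Finset ((G × G) × (G × G)) :=
  (braidPairs G ×ˢ braidPairs G).filter fun ((x, y), (z, t)) =>
    x * z = z * x ∧ y * t = t * y ∧ x * t * x * t = t * x * t * x ∧
    y * z * y * z = z * y * z * y ∧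
    (y⁻¹ * x * y) * (z⁻¹ * t * z) = (z⁻¹ * t * z) * (y⁻¹ * x * y) ∧
    (y * x * y⁻¹) * (z * t * z⁻¹) = (z * t * z⁻¹) * (y * x * y⁻¹)

/-- The solutions `((s 0, s 1), (s 2, s 3))` of the relations of the Artin group of type `F₄`. -/
def artinSolutions (G : Type*) [Group G] [Fintype G] [DecidableEq G] :
    Finset ((G × G) × (G × G)) :=
  (braidPairs G ×ˢ braidPairs G).filter fun ((x, y), (z, t)) =>
    x * z = z * x ∧ y * t = t * y ∧ x * t = t * x ∧ y * z * y * z = z * y * z * y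

/-- Quadruples as pairs of pairs. -/
def quadEquiv (G : Type*) : (Fin 4 → G) ≃ (G × G) × (G × G) where
  toFun s := ((s 0, s 1), (s 2, s 3))
  invFun p := ![p.1.1, p.1.2, p.2.1, p.2.2]
  left_inv s := by
    ext i
    fin_cases i <;> rfl
  right_inv _ := rfl

theorem card_hom_eq (rels : Set (FreeGroup (Fin 4))) (S : Finset ((G × G) × (G × G)))
    (h : ∀ s : Fin 4 → G, (∀ x ∈ rels, FreeGroup.lift s x = 1) ↔ quadEquiv G s ∈ S) :
    Nat.card (PresentedGroup rels →* G) = S.card := by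
  rw [Nat.card_congr (homEquiv rels), Nat.card_congr ((quadEquiv G).subtypeEquiv h),
    Nat.card_eq_fintype_card, Fintype.card_coe]

variable [Fintype G] [DecidableEq G]

variable (G) in
theorem card_hom_relsF₄a₁ :
    Nat.card (PresentedGroup relsF₄a₁ →* G) = (carterSolutions G).card := by
  refine card_hom_eq _ _ fun s => (lift_relsF₄a₁_iff s).trans ?_
  simp only [carterSolutions, braidPairs, quadEquiv, Finset.mem_filter, Finset.mem_product,
    Finset.mem_univ, true_and]
  exact ⟨fun h => ⟨⟨h.braid₀₁, h.braid₂₃⟩, h.comm₀₂, h.comm₁₃, h.braid₀₃, h.braid₁₂, h.twisted,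
      h.twisted'⟩,
    fun ⟨⟨h₁, h₂⟩, h₃, h₄, h₅, h₆, h₇, h₈⟩ => ⟨h₁, h₂, h₅, h₆, h₃, h₄, h₇, h₈⟩⟩

variable (G) in
theorem card_hom_artinGroup :
    Nat.card (ArtinGroup CoxeterMatrix.F₄ →* G) = (artinSolutions G).card := by
  refine card_hom_eq _ _ fun s => (lift_braidRels_F₄_iff s).trans ?_
  simp only [artinSolutions, braidPairs, quadEquiv, Finset.mem_filter, Finset.mem_product,
    Finset.mem_univ, true_and]
  exact ⟨fun h => ⟨⟨h.braid₀₁, h.braid₂₃⟩, h.comm₀₂, h.comm₁₃, h.comm₀₃, h.braid₁₂⟩,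
    fun ⟨⟨h₁, h₂⟩, h₃, h₄, h₅, h₆⟩ => ⟨h₁, h₂, h₆, h₃, h₄, h₅⟩⟩

/-- The alternating group of degree 4, in a form suited to computation: the semidirect product of
the group `{0, 1, 2, 3}` with bitwise addition by the group `ℤ/3`. -/
def Tetrahedral : Type := Fin 3 × Fin 4

namespace Tetrahedral

instance : Fintype Tetrahedral := inferInstanceAs (Fintype (Fin 3 × Fin 4))

instance : DecidableEq Tetrahedral := inferInstanceAs (DecidableEq (Fin 3 × Fin 4))

/-- The automorphism permuting `1, 2, 3` cyclically by `k` steps. -/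
def rotation (k : Fin 3) (v : Fin 4) : Fin 4 :=
  if v = 0 then 0 else ⟨(v + 2 + k) % 3 + 1, by lia⟩

instance : Group Tetrahedral where
  mul a b := (a.1 + b.1, a.2 ^^^ rotation a.1 b.2)
  one := (0, 0)
  inv a := (-a.1, rotation (-a.1) a.2)
  mul_assoc := by decide +kernel
  one_mul := by decide +kernel
  mul_one := by decide +kernel
  inv_mul_cancel := by decide +kernel

end Tetrahedral

theorem card_carterSolutions : (carterSolutions Tetrahedral).card = 120 := by
  decide +kernel

theorem card_artinSolutions : (artinSolutions Tetrahedral).card = 96 := by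
  decide +kernel

/-- The group presented by `F₄(a₁)` is not isomorphic to the Artin group of type `F₄`: the two have
different numbers of homomorphisms to the alternating group of degree 4. -/
theorem isEmpty_mulEquiv_artinGroup :
    IsEmpty (PresentedGroup relsF₄a₁ ≃* ArtinGroup CoxeterMatrix.F₄) := by
  refine ⟨fun e => ?_⟩
  have h : Nat.card (PresentedGroup relsF₄a₁ →* Tetrahedral) =
      Nat.card (ArtinGroup CoxeterMatrix.F₄ →* Tetrahedral) :=
    Nat.card_congr (e.monoidHomCongrLeftEquiv)
  rw [card_hom_relsF₄a₁, card_hom_artinGroup, card_carterSolutions, card_artinSolutions] at h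
  norm_num at h

end Count

end F₄

end DualCoxeter

theorem mainTheorem7 {W : Type*} [Group W] (cs : CoxeterSystem CoxeterMatrix.F₄ W) (w : W)
    (hw : DualCoxeter.IsProperQuasiCoxeter cs w) :
    (∃ t : Fin 4 → W, DualCoxeter.IsCarterDiagram cs DualCoxeter.carterF₄a₁ t w ∧
      ∃ φ : PresentedGroup DualCoxeter.relsF₄a₁ ≃* DualCoxeter.IntervalGroup cs w,
        ∀ i : Fin 4, ∃ hi : t i ∈ DualCoxeter.interval cs w,
          φ (PresentedGroup.of i) = PresentedGroup.of ⟨t i, hi⟩) ∧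
    IsEmpty (DualCoxeter.IntervalGroup cs w ≃* DualCoxeter.ArtinGroup CoxeterMatrix.F₄) := by
  obtain ⟨r, hr⟩ := DualCoxeter.F₄.exists_isFrame cs hw
  have hlen := DualCoxeter.F₄.reflectionLength_eq_four cs hw.1
  obtain ⟨φ, hφ⟩ := hr.exists_mulEquiv hlen
  exact ⟨⟨fun i => r i, hr.isCarterDiagram hlen, φ, hφ⟩,
    ⟨fun e => DualCoxeter.F₄.isEmpty_mulEquiv_artinGroup.false (φ.trans e)⟩⟩
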